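/- **Setting.** Consider $\min_{x\in X_0} f(x)=\mathbb E[F(x,\xi)]$ subject to $g_i(x)=\mathbb E[G_i(x,\xi)]\le 0$, $i=1,\dots,p$, where $X_0\subset\mathbb R^n$ is nonempty, closed and convex, $\mathcal O_0\supseteq X_0$ is open and convex, $\xi$ is a random vector supported on $\Xi\subseteq\mathbb R^q$, the functions $F(\cdot,\xi),G_i(\cdot,\xi)$ are differentiable on $\mathcal O_0$ for $\xi\in\Xi$, and $f,g_i$ are finite-valued and continuous on $\mathcal O_0$. Let $D_0,\nu_g,\kappa_f,\kappa_g,\epsilon_0,L_0,\dots,L_p,\kappa_\Sigma,\rho_c>0$ be such that * $\|x-z\|\le D_0$ for $x,z\in X_0$; $\|G(x,\xi)\|\le\nu_g$, $\|\nabla_xF(x,\xi)\|\le\kappa_f$, $\|\nabla_xG_i(x,\xi)\|\le\kappa_g$ for $(x,\xi)\in\mathcal O_0\times\Xi$; * there is $\widehat x\in X_0$ with $g_i(\widehat x)\le-\epsilon_0$ for all $i$; * for each $\xi\in\Xi$, $F(\cdot,\xi)$ is $L_0$-weakly convex and $G_i(\cdot,\xi)$ is $L_i$-weakly convex over $\mathcal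 O_0$ ($h$ is $L$-weakly convex if $h+\frac L2\|\cdot\|^2$ is convex); * (Assumption C) $\mathbb E\big[\exp\{(G_i(x,\xi)-g_i(x))^2/\rho_c^2\}\big]\le e$ for all $x\in X_0$ and all $i$; * $\sqrt p\,\kappa_\Sigma D_0^2\le\epsilon_0$. **Algorithm (PMQSopt).** Let $\xi_1,\xi_2,\dots$ be an i.i.d. sample of $\xi$, $x^1\in X_0$ deterministic, $\lambda^1=0\in\mathbb R^p$. For $t=1,\dots,T$ choose symmetric matrices $\Sigma_i^t$ with $\Sigma_i^t\preceq-L_iI$ and $\|\Sigma_i^t\|\le\kappa_\Sigma$ ($i=1,\dots,p$), put $\Sigma_0^t=-\sum_{i=1}^p\lambda_i^t\Sigma_i^t+\tau I$, $$q_0^t(x)=F(x^t,\xi_t)+\langle\nabla_xF(x^t,\xi_t),x-x^t\rangle+\tfrac12\langle\Sigma_0^t(x-x^t),x-x^t\rangle,$$ $$q_i^t(x)=G_i(x^t,\xi_t)+\langle\nabla_xG_i(x^t,\xi_t),x-x^t\rangle+\tfrac12\langle\Sigma_i^t(x-x^t),x-x^t\rangle,$$ and, with $[a]_+=\max\{a,0\}$,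 $$x^{t+1}\in\arg\min_{x\in X_0}\Big\{q_0^t(x)+\tfrac1{2\sigma}\Big[\sum_{i=1}^p[\lambda_i^t+\sigma q_i^t(x)]_+^2-\|\lambda^t\|^2\Big]+\tfrac\alpha2\|x-x^t\|^2\Big\},\qquad \lambda_i^{t+1}=[\lambda_i^t+\sigma q_i^t(x^{t+1})]_+ .$$ For $1\le t\le T+1$, $x^t$ and $\lambda^t$ are measurable functions of $(\xi_1,\dots,\xi_{t-1})$. The parameters are $\sigma=T^{-3/4}$, $\alpha=\beta T^{1/4}$, $\tau=T^{1/2}$. **Constants.** $\gamma_1=\nu_g+\sqrt p\,(\kappa_gD_0+\frac12\kappa_\Sigma D_0^2)$, $\gamma_2=\nu_g+\kappa_gD_0+\frac12\kappa_\Sigma D_0^2$, $\beta=2\big[L_0+\sum_{j=1}^p\gamma_2L_j\big]+1$, $\kappa_0=\frac{4\kappa_fD_0}{\epsilon_0}$, $\kappa_1=\frac{2D_0^2}{\epsilon_0}$, $\kappa_3=\frac{2\nu_g^2}{\epsilon_0}-\gamma_1$, $\kappa_4=2\gamma_1+\frac{\epsilon_0}4+\frac{16\gamma_1^2}{\epsilon_0}\log\frac{128\gamma_1^2}{\epsilon_0^2}$,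 $\rho_1=(2\kappa_g+\kappa_\Sigma D_0)\kappa_f$, $\rho_2=(2\kappa_g+\kappa_\Sigma D_0)(\kappa_g+\frac12\kappa_\Sigma D_0)\sqrt p$, $$\widehat\phi(T,\eta)=\kappa_0+\kappa_1+(\kappa_1\beta+\kappa_4)T^{-1/4}+\kappa_3T^{-3/4}+16\beta\frac{\gamma_1^2}{\epsilon_0}\big(\eta+\log(T+1)\big)T^{-1/4},$$ $$\pi_c(T,\eta)=\rho_1\beta^{-1}T^{3/4}+\rho_2\beta^{-1}\nu_g+\eta\rho_c\sqrt T+(1+\beta^{-1}\rho_2)\,\widehat\phi(T,\eta)\,T^{3/4}.$$ **Proposition.** If $T>\max\{\beta^2,\ \beta^{-1}p(\kappa_g+\kappa_\Sigma D_0/2)^2,\ (\kappa_\Sigma\gamma_2)^4\}$, then for every $\eta>1$ and every $i=1,\dots,p$, $$\Pr\Big[\sum_{t=1}^Tg_i(x^t)\le\pi_c(T,\eta)\Big]\ \ge\ 1-e^{-\eta}-e^{-\eta^2/3}.$$ Moreover, for fixed $\eta$ and fixed constants, $\pi_c(T,\eta)$ is of exact order $T^{3/4}$ as $T\to\infty$,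 that is, $\pi_c(T,\eta)=\Theta(T^{3/4})$. -/

import Mathlib

open MeasureTheory ProbabilityTheory

namespace PMQS

noncomputable section

/-- `ℝ^m` with its Euclidean norm. -/
abbrev Vec (m : ℕ) : Type := EuclideanSpace ℝ (Fin m)

/-- Symmetric `m × m` matrices are represented by self-adjoint operators on `ℝ^m`; the operator norm
is the spectral norm. -/
abbrev Op (m : ℕ) : Type := Vec m →L[ℝ] Vec m

/-- The data of the problem `min E[F(x,ξ)]` over `x ∈ X₀` subject to `E[G_i(x,ξ)] ≤ 0`,
`i = 1,…,p`; here `law` is the distribution of `ξ`, supported on `Xi ⊆ ℝ^q`, and the values of `F`,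
`G` matter on `O₀ × Xi` only. -/
structure Problem (n p q : ℕ) where
  X₀ : Set (Vec n)
  O₀ : Set (Vec n)
  Xi : Set (Vec q)
  law : Measure (Vec q)
  F : Vec n → Vec q → ℝ
  G : Fin p → Vec n → Vec q → ℝ

variable {n p q : ℕ}

/-- `f(x) = E[F(x,ξ)]`. -/
def Problem.f (Q : Problem n p q) (x : Vec n) : ℝ := ∫ s, Q.F x s ∂Q.law

/-- `g_i(x) = E[G_i(x,ξ)]`. -/
def Problem.g (Q : Problem n p q) (i : Fin p) (x : Vec n) : ℝ := ∫ s, Q.G i x s ∂Q.law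

/-- `∇ₓ F(x,s)`. -/
def Problem.gradF (Q : Problem n p q) (x : Vec n) (s : Vec q) : Vec n :=
  gradient (fun y => Q.F y s) x

/-- `∇ₓ G_i(x,s)`. -/
def Problem.gradG (Q : Problem n p q) (i : Fin p) (x : Vec n) (s : Vec q) : Vec n :=
  gradient (fun y => Q.G i y s) x

/-- `h` is `L`-weakly convex over `S`. -/
def WeaklyConvexOn (S : Set (Vec n)) (L : ℝ) (h : Vec n → ℝ) : Prop :=
  ConvexOn ℝ S (fun x => h x + L / 2 * ‖x‖ ^ 2)

/-- The standing conventions on the data: `X₀` is nonempty, closed and convex, `O₀` is an open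
convex set containing it, `ξ` takes its values in `Xi`, the problem functions are differentiable in
`x`, and the expectations are finite and continuous on `O₀`. -/
structure Problem.Standing (Q : Problem n p q) : Prop where
  nonempty_X₀ : Q.X₀.Nonempty
  closed_X₀ : IsClosed Q.X₀
  convex_X₀ : Convex ℝ Q.X₀
  open_O₀ : IsOpen Q.O₀
  convex_O₀ : Convex ℝ Q.O₀
  subset : Q.X₀ ⊆ Q.O₀
  prob : IsProbabilityMeasure Q.law
  support : ∀ᵐ s ∂Q.law, s ∈ Q.Xi
  diff_F : ∀ s ∈ Q.Xi, ∀ x ∈ Q.O₀, DifferentiableAt ℝ (fun y => Q.F y s) x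
  diff_G : ∀ i, ∀ s ∈ Q.Xi, ∀ x ∈ Q.O₀, DifferentiableAt ℝ (fun y => Q.G i y s) x
  integrable_F : ∀ x ∈ Q.O₀, Integrable (Q.F x) Q.law
  integrable_G : ∀ i, ∀ x ∈ Q.O₀, Integrable (Q.G i x) Q.law
  continuous_f : ContinuousOn Q.f Q.O₀
  continuous_g : ∀ i, ContinuousOn (Q.g i) Q.O₀

/-- The constants occurring in the assumptions: diameter bound `D₀`, bound `ν` for `‖G‖`, gradient
bounds `κf`, `κg`, Slater constant `ε₀`, weak convexity moduli `L₀` (of `F`) and `L i` (of `G_i`),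
bound `κS` for the norms of the matrices `Σ_i^t`, and light-tail constant `ρc`. -/
structure Constants (p : ℕ) where
  D₀ : ℝ
  ν : ℝ
  κf : ℝ
  κg : ℝ
  ε₀ : ℝ
  L₀ : ℝ
  L : Fin p → ℝ
  κS : ℝ
  ρc : ℝ

/-- The constants are positive. -/
structure Constants.Pos (c : Constants p) : Prop where
  D₀ : 0 < c.D₀
  ν : 0 < c.ν
  κf : 0 < c.κf
  κg : 0 < c.κg
  ε₀ : 0 < c.ε₀
  L₀ : 0 < c.L₀
  L : ∀ i, 0 < c.L i
  κS : 0 < c.κS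
  ρc : 0 < c.ρc

/-- The assumptions on the problem: bounded `X₀`, bounded `G`, bounded gradients, strict
feasibility, and weak convexity. -/
structure Problem.Assumptions (Q : Problem n p q) (c : Constants p) : Prop where
  diam : ∀ x ∈ Q.X₀, ∀ z ∈ Q.X₀, ‖x - z‖ ≤ c.D₀
  bound_G : ∀ x ∈ Q.O₀, ∀ s ∈ Q.Xi, ‖(WithLp.toLp 2 (fun i => Q.G i x s) : Vec p)‖ ≤ c.ν
  bound_gradF : ∀ x ∈ Q.O₀, ∀ s ∈ Q.Xi, ‖Q.gradF x s‖ ≤ c.κf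
  bound_gradG : ∀ i, ∀ x ∈ Q.O₀, ∀ s ∈ Q.Xi, ‖Q.gradG i x s‖ ≤ c.κg
  slater : ∃ x ∈ Q.X₀, ∀ i, Q.g i x ≤ -c.ε₀
  weak_F : ∀ s ∈ Q.Xi, WeaklyConvexOn Q.O₀ c.L₀ (fun x => Q.F x s)
  weak_G : ∀ i, ∀ s ∈ Q.Xi, WeaklyConvexOn Q.O₀ (c.L i) (fun x => Q.G i x s)

/-- The light-tail assumption `E[exp((G_i(x,ξ) - g_i(x))² / ρ_c²)] ≤ exp 1` for all `x ∈ X₀`. -/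
def Problem.LightTail (Q : Problem n p q) (c : Constants p) : Prop :=
  ∀ x ∈ Q.X₀, ∀ i,
    Integrable (fun s => Real.exp ((Q.G i x s - Q.g i x) ^ 2 / c.ρc ^ 2)) Q.law ∧
      ∫ s, Real.exp ((Q.G i x s - Q.g i x) ^ 2 / c.ρc ^ 2) ∂Q.law ≤ Real.exp 1

/-! The algorithm. In what follows `xt`, `lamt`, `s` and `S i` stand for `x^t`, `λ^t`, `ξ_t`
and `Σ_i^t` (`i = 1,…,p`). -/

/-- `Σ_0^t = -∑ λ_i^t Σ_i^t + τ I`. -/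
def sigmaZero (τ : ℝ) (lamt : Vec p) (S : Fin p → Op n) : Op n :=
  -(∑ i, lamt i • S i) + τ • ContinuousLinearMap.id ℝ (Vec n)

/-- The quadratic approximation `q_0^t` of `F(·,ξ_t)` at `x^t`, with matrix `S₀`. -/
def Problem.qObj (Q : Problem n p q) (xt : Vec n) (s : Vec q) (S₀ : Op n) (x : Vec n) : ℝ :=
  Q.F xt s + inner ℝ (Q.gradF xt s) (x - xt) + 1 / 2 * inner ℝ (S₀ (x - xt)) (x - xt)

/-- The quadratic approximation `q_i^t` of `G_i(·,ξ_t)` at `x^t`, with matrix `Si`. -/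
def Problem.qCon (Q : Problem n p q) (i : Fin p) (xt : Vec n) (s : Vec q) (Si : Op n)
    (x : Vec n) : ℝ :=
  Q.G i xt s + inner ℝ (Q.gradG i xt s) (x - xt) + 1 / 2 * inner ℝ (Si (x - xt)) (x - xt)

/-- The augmented Lagrangian `𝓛_σ^t(x,λ)` of the quadratic approximation. -/
def Problem.augLag (Q : Problem n p q) (σ : ℝ) (xt : Vec n) (s : Vec q) (S₀ : Op n)
    (S : Fin p → Op n) (x : Vec n) (lam : Vec p) : ℝ :=
  Q.qObj xt s S₀ x +
    1 / (2 * σ) * (∑ i, (max (lam i + σ * Q.qCon i xt s (S i) x) 0) ^ 2 - ‖lam‖ ^ 2)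

/-- `(x^t, λ^t)`, `t = 1,…,T+1`, is produced by `T` iterations of PMQSopt with parameters
`σ, α, τ`, starting point `x₁`, sample path `z` and matrices `S t i = Σ_i^t`. -/
structure Problem.IsPath (Q : Problem n p q) (σ α τ : ℝ) (T : ℕ) (x₁ : Vec n) (z : ℕ → Vec q)
    (S : ℕ → Fin p → Op n) (x : ℕ → Vec n) (lam : ℕ → Vec p) : Prop where
  init_x : x 1 = x₁
  init_lam : lam 1 = 0
  symm : ∀ t ∈ Finset.Icc 1 T, ∀ i, IsSelfAdjoint (S t i)
  mem : ∀ t ∈ Finset.Icc 1 T, x (t + 1) ∈ Q.X₀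
  argmin : ∀ t ∈ Finset.Icc 1 T,
    IsMinOn (fun y => Q.augLag σ (x t) (z t) (sigmaZero τ (lam t) (S t)) (S t) y (lam t)
      + α / 2 * ‖y - x t‖ ^ 2) Q.X₀ (x (t + 1))
  step_lam : ∀ t ∈ Finset.Icc 1 T, ∀ i,
    lam (t + 1) i = max (lam t i + σ * Q.qCon i (x t) (z t) (S t i) (x (t + 1))) 0

/-- The choice of the matrices: `Σ_i^t ⪯ -L_i I` and `‖Σ_i^t‖ ≤ κ_Σ`. -/
def Constants.Admissible (c : Constants p) (T : ℕ) (S : ℕ → Fin p → Op n) : Prop :=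
  ∀ t ∈ Finset.Icc 1 T, ∀ i,
    (∀ v : Vec n, inner ℝ (S t i v) v ≤ -c.L i * ‖v‖ ^ 2) ∧ ‖S t i‖ ≤ c.κS

/-- `ξ_1, ξ_2, …` is an i.i.d. sample from the distribution of `ξ`. -/
structure Problem.IsIIDSample (Q : Problem n p q) {Ω : Type*} [MeasurableSpace Ω] (Pr : Measure Ω)
    (ξ : ℕ → Ω → Vec q) : Prop where
  meas : ∀ t, 1 ≤ t → Measurable (ξ t)
  law : ∀ t, 1 ≤ t → Pr.map (ξ t) = Q.law
  indep : iIndepFun (fun t : ℕ => ξ (t + 1)) Pr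

/-- The σ-algebra generated by the history `ξ_[t-1] = (ξ_1,…,ξ_{t-1})`. -/
abbrev history {Ω : Type*} (ξ : ℕ → Ω → Vec q) (t : ℕ) : MeasurableSpace Ω :=
  ⨆ k ∈ Set.Ico 1 t, MeasurableSpace.comap (ξ k) inferInstance

/-! The constants derived from the basic ones. -/

namespace Constants

def γ₁ (c : Constants p) : ℝ :=
  c.ν + Real.sqrt p * (c.κg * c.D₀ + 1 / 2 * c.κS * c.D₀ ^ 2)

def γ₂ (c : Constants p) : ℝ := c.ν + (c.κg * c.D₀ + c.κS * c.D₀ ^ 2 / 2)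

def β (c : Constants p) : ℝ := 2 * (c.L₀ + ∑ j, c.γ₂ * c.L j) + 1

def κ₀ (c : Constants p) : ℝ := 4 * c.κf * c.D₀ / c.ε₀

def κ₁ (c : Constants p) : ℝ := 2 * c.D₀ ^ 2 / c.ε₀

def κ₃ (c : Constants p) : ℝ := 2 * c.ν ^ 2 / c.ε₀ - c.γ₁

def κ₄ (c : Constants p) : ℝ :=
  2 * c.γ₁ + c.ε₀ / 4 + 16 * c.γ₁ ^ 2 / c.ε₀ * Real.log (128 * c.γ₁ ^ 2 / c.ε₀ ^ 2)

def ρ₁ (c : Constants p) : ℝ := (2 * c.κg + c.κS * c.D₀) * c.κf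

def ρ₂ (c : Constants p) : ℝ :=
  (2 * c.κg + c.κS * c.D₀) * (c.κg + c.κS * c.D₀ / 2) * Real.sqrt p

def phiHat (c : Constants p) (T : ℕ) (η : ℝ) : ℝ :=
  c.κ₀ + c.κ₁ + (c.κ₁ * c.β + c.κ₄) * (T : ℝ) ^ (-(1 / 4) : ℝ) + c.κ₃ * (T : ℝ) ^ (-(3 / 4) : ℝ)
    + 16 * c.β * (c.γ₁ ^ 2 / c.ε₀) * (η + Real.log ((T : ℝ) + 1)) * (T : ℝ) ^ (-(1 / 4) : ℝ)

/-- The bound `π_c(T,η)`. -/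
def piC (c : Constants p) (T : ℕ) (η : ℝ) : ℝ :=
  c.ρ₁ * c.β⁻¹ * (T : ℝ) ^ (3 / 4 : ℝ) + c.ρ₂ * c.β⁻¹ * c.ν + η * c.ρc * Real.sqrt T
    + (1 + c.β⁻¹ * c.ρ₂) * c.phiHat T η * (T : ℝ) ^ (3 / 4 : ℝ)

end Constants

end

end PMQS

/-! Fix a Slater point `z` and put V_t² = ‖λ^t‖² + σ(τ+α)‖z - x^t‖². The constraint models are
concave, yet the subproblem still grows quadratically around its minimizer, because Σ_0^t carries -∑
λ_i^t Σ_i^t, which cancels their curvature up to the multiplier increments (`segment`). Comparing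
the minimizer with `z` gives V_{t+1}² ≤ V_t² + 2σ(∑ λ_i^t G_i(z,ξ_t) + (ε₀/2)‖λ^t‖ + C)
(`lyapunov`). Given the past, the sum has mean at most -ε₀‖λ^t‖, so V drifts downwards once it is
large.

Hoeffding's lemma turns this into E exp(r V_{t+1}) ≤ E exp(r V_t) + const (`lintegral_exp_drift`).
Iterating, then applying Chernoff and a union bound over t ≤ T+1, gives ‖λ^t‖ ≤ `phiHat` for all t,
outside an event of probability at most e^{-η} (`measure_norm_lam_gt_le`).

The multiplier update telescopes: ∑ G_i(x^t,ξ_t) is at most λ_i^{T+1}/σ plus a multiple of the step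
lengths (`sum_G_le`), and those are controlled by ‖λ^t‖/α (`norm_step_le`). The remaining sum of
g_i(x^t) - G_i(x^t,ξ_t) is a martingale with light-tailed increments, of size at most ηρ_c√T outside
an event of probability e^{-η²/3} (`measure_samplingError_le`). The three bounds add up exactly to
`piC`. -/

namespace PMQS

/-! ### Squared positive parts of quadratics along a segment. -/

section Scalar

/-- The square of the positive part is convex with derivative 2·max(a,0), so it lies above its
tangents. The companion `max_add_sq_le` uses that this derivative is 2-Lipschitz. -/
theorem max_add_sq_ge (a b : ℝ) : max a 0 ^ 2 + 2 * b * max a 0 ≤ max (a + b) 0 ^ 2 := by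
  rcases le_total a 0 with h | h
  · rw [max_eq_right h]; nlinarith [sq_nonneg (max (a + b) 0)]
  · rw [max_eq_left h]
    rcases le_total (a + b) 0 with h' | h'
    · rw [max_eq_right h']; nlinarith
    · rw [max_eq_left h']; nlinarith [sq_nonneg b]

theorem max_add_sq_le (a b : ℝ) :
    max (a + b) 0 ^ 2 ≤ max a 0 ^ 2 + 2 * b * max a 0 + b ^ 2 := by
  rcases le_total a 0 with h | h
  · rw [max_eq_right h]
    rcases le_total (a + b) 0 with h' | h'
    · rw [max_eq_right h']; nlinarith [sq_nonneg b]
    · rw [max_eq_left h']; nlinarith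
  · rw [max_eq_left h]
    rcases le_total (a + b) 0 with h' | h'
    · rw [max_eq_right h']; nlinarith [sq_nonneg (a + b)]
    · rw [max_eq_left h']; nlinarith

/-- Second-order growth of a sum of squared positive parts of quadratics along a segment whose
initial point is the minimizer. -/
theorem segment_growth {ι : Type*} [Fintype ι] {σ : ℝ} (hσ : 0 < σ) (c₁ c₂ : ℝ) (A B C : ι → ℝ)
    (hmin : ∀ θ : ℝ, 0 < θ → θ ≤ 1 →
      1 / (2 * σ) * ∑ i, max (A i) 0 ^ 2 ≤ c₁ * θ + c₂ * θ ^ 2 +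
        1 / (2 * σ) * ∑ i, max (A i + σ * (B i * θ + C i * θ ^ 2)) 0 ^ 2) :
    1 / (2 * σ) * ∑ i, max (A i) 0 ^ 2 + c₂ + ∑ i, C i * max (A i) 0 ≤ c₁ + c₂ +
      1 / (2 * σ) * ∑ i, max (A i + σ * (B i + C i)) 0 ^ 2 := by
  have hl : 0 ≤ c₁ + ∑ i, B i * max (A i) 0 := by
    -- The quantity to be shown nonnegative is the right derivative at θ = 0; `K` bounds the
    -- second-order remainder on (0,1].
    set K : ℝ := |c₂ + ∑ i, C i * max (A i) 0| + σ / 2 * ∑ i, (|B i| + |C i|) ^ 2 with hK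
    have hK0 : 0 ≤ K := by
      have : 0 ≤ ∑ i, (|B i| + |C i|) ^ 2 := Finset.sum_nonneg fun i _ => sq_nonneg _
      positivity
    have key : ∀ θ : ℝ, 0 < θ → θ ≤ 1 → -(K * θ) ≤ c₁ + ∑ i, B i * max (A i) 0 := by
      intro θ h0 h1
      have h := hmin θ h0 h1
      have hs : ∑ i, max (A i + σ * (B i * θ + C i * θ ^ 2)) 0 ^ 2 ≤
          ∑ i, (max (A i) 0 ^ 2 + 2 * σ * (θ * (B i * max (A i) 0)
            + θ ^ 2 * (C i * max (A i) 0)) + σ ^ 2 * θ ^ 2 * (|B i| + |C i|) ^ 2) := by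
        refine Finset.sum_le_sum fun i _ => (max_add_sq_le _ _).trans ?_
        have hb : (B i + C i * θ) ^ 2 ≤ (|B i| + |C i|) ^ 2 := by
          apply sq_le_sq'
          · have := neg_abs_le (B i)
            have h2 : |C i * θ| ≤ |C i| := by
              rw [abs_mul, abs_of_pos h0]; exact mul_le_of_le_one_right (abs_nonneg _) h1
            linarith [neg_abs_le (C i * θ)]
          · have := le_abs_self (B i)
            have h2 : |C i * θ| ≤ |C i| := by
              rw [abs_mul, abs_of_pos h0]; exact mul_le_of_le_one_right (abs_nonneg _) h1
            linarith [le_abs_self (C i * θ)]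
        have : 0 ≤ σ ^ 2 * θ ^ 2 := by positivity
        nlinarith [mul_le_mul_of_nonneg_left hb this]
      rw [Finset.sum_add_distrib, Finset.sum_add_distrib, ← Finset.mul_sum, ← Finset.mul_sum,
        Finset.sum_add_distrib, ← Finset.mul_sum, ← Finset.mul_sum] at hs
      have hσ' : 0 < 1 / (2 * σ) := by positivity
      have h3 := mul_le_mul_of_nonneg_left hs hσ'.le
      set P := ∑ i, max (A i) 0 ^ 2
      set U := ∑ i, B i * max (A i) 0
      set W := ∑ i, C i * max (A i) 0
      set R := ∑ i, (|B i| + |C i|) ^ 2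
      have h4 : 1 / (2 * σ) * (P + 2 * σ * (θ * U + θ ^ 2 * W) + σ ^ 2 * θ ^ 2 * R)
          = 1 / (2 * σ) * P + (θ * U + θ ^ 2 * W) + σ / 2 * θ ^ 2 * R := by
        field_simp
      rw [h4] at h3
      have h5 : 0 ≤ θ * (c₁ + U + θ * (c₂ + W) + σ / 2 * θ * R) := by nlinarith
      have h6 := nonneg_of_mul_nonneg_right h5 h0
      have h7 := le_abs_self (c₂ + W)
      have h8 := mul_le_mul_of_nonneg_left h7 h0.le
      rw [hK]
      nlinarith
    by_contra! hneg
    have h1 := key 1 one_pos le_rfl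
    have hKpos : 0 < K := by linarith
    set l := c₁ + ∑ i, B i * max (A i) 0
    -- If the derivative l were negative, this θ would give l/2 ≤ l, a contradiction. The bound at θ
    -- = 1 ensures θ ≤ 1.
    have h2 := key (-l / (2 * K)) (by apply div_pos <;> linarith) (by
      rw [div_le_one (by linarith)]; linarith)
    have h3 : K * (-l / (2 * K)) = -l / 2 := by field_simp
    rw [h3] at h2
    linarith
  -- Tangent inequality at the endpoint θ = 1; the first-order part is then discarded by `hl`.
  have hs : ∑ i, (max (A i) 0 ^ 2 + 2 * σ * (B i * max (A i) 0 + C i * max (A i) 0)) ≤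
      ∑ i, max (A i + σ * (B i + C i)) 0 ^ 2 :=
    Finset.sum_le_sum fun i _ => le_trans (by nlinarith) (max_add_sq_ge _ _)
  rw [Finset.sum_add_distrib, ← Finset.mul_sum, Finset.sum_add_distrib] at hs
  have h3 := mul_le_mul_of_nonneg_left hs (show 0 ≤ 1 / (2 * σ) by positivity)
  have h4 : ∀ P U W : ℝ, 1 / (2 * σ) * (P + 2 * σ * (U + W)) = 1 / (2 * σ) * P + (U + W) := by
    intro P U W; field_simp
  rw [h4] at h3
  linarith

end Scalar

/-! ### Deterministic analysis of one iteration. -/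

section Vector

variable {n p q : ℕ}

theorem sum_abs_le_sqrt_mul_norm (v : Vec p) : ∑ i, |v i| ≤ Real.sqrt p * ‖v‖ := by
  rw [EuclideanSpace.norm_eq, ← Real.sqrt_mul (Nat.cast_nonneg p)]
  apply Real.le_sqrt_of_sq_le
  have := sq_sum_le_card_mul_sum_sq (s := (Finset.univ : Finset (Fin p))) (f := fun i => |v i|)
  simpa using this

theorem abs_inner_op_le (A : Op n) (v : Vec n) : |inner ℝ (A v) v| ≤ ‖A‖ * ‖v‖ ^ 2 := by
  calc |inner ℝ (A v) v| ≤ ‖A v‖ * ‖v‖ := abs_real_inner_le_norm _ _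
    _ ≤ ‖A‖ * ‖v‖ * ‖v‖ := by gcongr; exact A.le_opNorm v
    _ = ‖A‖ * ‖v‖ ^ 2 := by ring

/-- First-order inequality for a weakly convex function. -/
theorem WeaklyConvexOn.gradient_le {O : Set (Vec n)} {L : ℝ} {h : Vec n → ℝ}
    (hw : WeaklyConvexOn O L h) {x y : Vec n} (hx : x ∈ O) (hy : y ∈ O)
    (hd : DifferentiableAt ℝ h x) :
    h x + inner ℝ (gradient h x) (y - x) - L / 2 * ‖y - x‖ ^ 2 ≤ h y := by
  -- On the segment from x to y, the derivative at 0 of the convexified function is at most its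
  -- slope over [0,1].
  have hconv := hw.comp_affineMap (AffineMap.lineMap x y : ℝ →ᵃ[ℝ] Vec n)
  have hg : HasFDerivAt h (InnerProductSpace.toDual ℝ (Vec n) (gradient h x)) x :=
    hd.hasGradientAt.hasFDerivAt
  have hl : HasDerivAt (fun θ : ℝ => (AffineMap.lineMap x y : ℝ →ᵃ[ℝ] Vec n) θ) (y - x) 0 :=
    AffineMap.hasDerivAt_lineMap
  have h0 : (AffineMap.lineMap x y : ℝ →ᵃ[ℝ] Vec n) (0 : ℝ) = x := AffineMap.lineMap_apply_zero _ _
  have h1 : HasDerivAt (fun θ : ℝ => h ((AffineMap.lineMap x y : ℝ →ᵃ[ℝ] Vec n) θ))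
      (inner ℝ (gradient h x) (y - x)) 0 := by
    have := HasFDerivAt.comp_hasDerivAt (x := (0 : ℝ)) (f := fun θ : ℝ =>
      (AffineMap.lineMap x y : ℝ →ᵃ[ℝ] Vec n) θ) (l := h) (by rw [h0]; exact hg) hl
    rw [InnerProductSpace.toDual_apply_apply] at this
    exact this
  have h2 : HasDerivAt (fun θ : ℝ => ‖(AffineMap.lineMap x y : ℝ →ᵃ[ℝ] Vec n) θ‖ ^ 2)
      (2 * inner ℝ x (y - x)) 0 := by
    have := hl.norm_sq
    simpa [h0] using this
  have h3 := h1.add (h2.const_mul (L / 2))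
  have h4 := hconv.le_slope_of_hasDerivAt (x := 0) (y := 1) (by simpa using hx) (by simpa using hy)
    one_pos h3
  have hn : ‖y‖ ^ 2 = ‖x‖ ^ 2 + 2 * inner ℝ x (y - x) + ‖y - x‖ ^ 2 := by
    rw [← norm_add_sq_real]; simp
  simp only [slope_def_field, Function.comp, AffineMap.lineMap_apply_zero,
    AffineMap.lineMap_apply_one, hn] at h4
  generalize inner ℝ (gradient h x) (y - x) = I at h4 ⊢
  norm_num at h4
  linarith

variable (Q : Problem n p q)

theorem qCon_add (i : Fin p) (xt : Vec n) (s : Vec q) {A : Op n} (hA : IsSelfAdjoint A)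
    (x w : Vec n) (θ : ℝ) :
    Q.qCon i xt s A (x + θ • w) = Q.qCon i xt s A x
      + ((inner ℝ (Q.gradG i xt s) w + inner ℝ (A (x - xt)) w) * θ
        + 1 / 2 * inner ℝ (A w) w * θ ^ 2) := by
  have hs : inner ℝ (A w) (x - xt) = inner ℝ (A (x - xt)) w := by
    have := ContinuousLinearMap.isSelfAdjoint_iff_isSymmetric.mp hA w (x - xt)
    rw [real_inner_comm w (A (x - xt))]; exact this
  have e : x + θ • w - xt = (x - xt) + θ • w := by abel
  simp only [Problem.qCon, e, map_add, map_smul, inner_add_left, inner_add_right,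
    real_inner_smul_left, real_inner_smul_right, hs]
  ring

theorem inner_sigmaZero (τ : ℝ) (lamt : Vec p) (S : Fin p → Op n) (v w : Vec n) :
    inner ℝ (sigmaZero τ lamt S v) w
      = -(∑ i, lamt i * inner ℝ (S i v) w) + τ * inner ℝ v w := by
  simp [sigmaZero, inner_add_left, sum_inner, real_inner_smul_left]

theorem isSelfAdjoint_sigmaZero (τ : ℝ) (lamt : Vec p) {S : Fin p → Op n}
    (hS : ∀ i, IsSelfAdjoint (S i)) : IsSelfAdjoint (sigmaZero τ lamt S) := by
  rw [ContinuousLinearMap.isSelfAdjoint_iff_isSymmetric]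
  intro v w
  have h1 : ∀ i, inner ℝ (S i v) w = inner ℝ (S i w) v := fun i =>
    (ContinuousLinearMap.isSelfAdjoint_iff_isSymmetric.mp (hS i) v w).trans
      (real_inner_comm _ _)
  have h2 : inner ℝ (sigmaZero τ lamt S v) w = inner ℝ (sigmaZero τ lamt S w) v := by
    simp only [inner_sigmaZero, h1, real_inner_comm w v]
  exact h2.trans (real_inner_comm _ _)

theorem qObj_add (xt : Vec n) (s : Vec q) {A : Op n} (hA : IsSelfAdjoint A)
    (x w : Vec n) (θ : ℝ) :
    Q.qObj xt s A (x + θ • w) = Q.qObj xt s A x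
      + ((inner ℝ (Q.gradF xt s) w + inner ℝ (A (x - xt)) w) * θ
        + 1 / 2 * inner ℝ (A w) w * θ ^ 2) := by
  have hs : inner ℝ (A w) (x - xt) = inner ℝ (A (x - xt)) w := by
    have := ContinuousLinearMap.isSelfAdjoint_iff_isSymmetric.mp hA w (x - xt)
    rw [real_inner_comm w (A (x - xt))]; exact this
  have e : x + θ • w - xt = (x - xt) + θ • w := by abel
  simp only [Problem.qObj, e, map_add, map_smul, inner_add_left, inner_add_right,
    real_inner_smul_left, real_inner_smul_right, hs]
  ring

/-- One iteration of the algorithm from `(xt, lamt)` to `(xp, lamp)` with sample `s`. -/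
structure Problem.IsStep (c : Constants p) (σ α τ : ℝ) (xt : Vec n) (lamt : Vec p) (s : Vec q)
    (S : Fin p → Op n) (xp : Vec n) (lamp : Vec p) : Prop where
  xt_mem : xt ∈ Q.X₀
  lamt_nonneg : ∀ i, 0 ≤ lamt i
  s_mem : s ∈ Q.Xi
  symm : ∀ i, IsSelfAdjoint (S i)
  admissible : ∀ i, (∀ v : Vec n, inner ℝ (S i v) v ≤ -c.L i * ‖v‖ ^ 2) ∧ ‖S i‖ ≤ c.κS
  xp_mem : xp ∈ Q.X₀
  argmin : IsMinOn (fun y => Q.augLag σ xt s (sigmaZero τ lamt S) S y lamt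
      + α / 2 * ‖y - xt‖ ^ 2) Q.X₀ xp
  step_lam : ∀ i, lamp i = max (lamt i + σ * Q.qCon i xt s (S i) xp) 0

namespace Problem.IsStep

variable {Q} {c : Constants p} {σ α τ : ℝ} {xt : Vec n} {lamt : Vec p} {s : Vec q}
  {S : Fin p → Op n} {xp : Vec n} {lamp : Vec p}

theorem inner_nonpos (hc : c.Pos) (h : Q.IsStep c σ α τ xt lamt s S xp lamp) (i : Fin p)
    (v : Vec n) : inner ℝ (S i v) v ≤ 0 := by
  have := (h.admissible i).1 v
  have h2 := mul_nonneg (hc.L i).le (sq_nonneg ‖v‖)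
  linarith

theorem neg_le_inner (h : Q.IsStep c σ α τ xt lamt s S xp lamp) (i : Fin p)
    (v : Vec n) : -(c.κS * ‖v‖ ^ 2) ≤ inner ℝ (S i v) v := by
  have h1 := neg_le_of_abs_le (abs_inner_op_le (S i) v)
  have h2 := mul_le_mul_of_nonneg_right (h.admissible i).2 (sq_nonneg ‖v‖)
  linarith

/-- Σ_i ⪯ -L_i I makes the model more concave than the lower quadratic supplied by weak convexity.
-/
theorem qCon_le (hQ : Q.Standing) (hA : Q.Assumptions c)
    (h : Q.IsStep c σ α τ xt lamt s S xp lamp) (i : Fin p) {y : Vec n} (hy : y ∈ Q.X₀) :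
    Q.qCon i xt s (S i) y ≤ Q.G i y s := by
  have h1 := (hA.weak_G i s h.s_mem).gradient_le (hQ.subset h.xt_mem) (hQ.subset hy)
    (hQ.diff_G i s h.s_mem xt (hQ.subset h.xt_mem))
  have h2 := (h.admissible i).1 (y - xt)
  simp only [Problem.qCon, Problem.gradG]
  linarith

theorem norm_sub_sq_le (hA : Q.Assumptions c) {y z : Vec n} (hy : y ∈ Q.X₀) (hz : z ∈ Q.X₀) :
    ‖y - z‖ ^ 2 ≤ c.D₀ ^ 2 := by
  have := hA.diam y hy z hz
  gcongr

/-- Substitute for strong convexity of the subproblem. The constraint terms contribute curvature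
weighted by the new multipliers, Σ_0 contributes its negative weighted by the old ones, and only the
difference survives. -/
theorem segment (hQ : Q.Standing) (hσ : 0 < σ)
    (h : Q.IsStep c σ α τ xt lamt s S xp lamp) {z : Vec n} (hz : z ∈ Q.X₀) :
    Q.augLag σ xt s (sigmaZero τ lamt S) S xp lamt + α / 2 * ‖xp - xt‖ ^ 2
        + (τ + α) / 2 * ‖z - xp‖ ^ 2
        + 1 / 2 * ∑ i, (lamp i - lamt i) * inner ℝ (S i (z - xp)) (z - xp)
      ≤ Q.augLag σ xt s (sigmaZero τ lamt S) S z lamt + α / 2 * ‖z - xt‖ ^ 2 := by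
  set w := z - xp with hw
  have hmem : ∀ θ : ℝ, 0 < θ → θ ≤ 1 → xp + θ • w ∈ Q.X₀ := fun θ h0 h1 =>
    hQ.convex_X₀.add_smul_sub_mem h.xp_mem hz ⟨h0.le, h1⟩
  have hS₀ := isSelfAdjoint_sigmaZero τ lamt h.symm
  set c₁ := inner ℝ (Q.gradF xt s) w + inner ℝ (sigmaZero τ lamt S (xp - xt)) w
    + α * inner ℝ (xp - xt) w with hc₁
  set c₂ := 1 / 2 * inner ℝ (sigmaZero τ lamt S w) w + α / 2 * ‖w‖ ^ 2 with hc₂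
  have hnorm : ∀ θ : ℝ, ‖xp + θ • w - xt‖ ^ 2
      = ‖xp - xt‖ ^ 2 + 2 * (θ * inner ℝ (xp - xt) w) + θ ^ 2 * ‖w‖ ^ 2 := by
    intro θ
    have e : xp + θ • w - xt = (xp - xt) + θ • w := by abel
    rw [e, norm_add_sq_real, real_inner_smul_right, norm_smul, mul_pow, Real.norm_eq_abs, sq_abs]
  have hobj : ∀ θ : ℝ, Q.augLag σ xt s (sigmaZero τ lamt S) S (xp + θ • w) lamt
      + α / 2 * ‖xp + θ • w - xt‖ ^ 2
      = (Q.qObj xt s (sigmaZero τ lamt S) xp + α / 2 * ‖xp - xt‖ ^ 2 - 1 / (2 * σ) * ‖lamt‖ ^ 2)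
        + (c₁ * θ + c₂ * θ ^ 2 + 1 / (2 * σ) * ∑ i, max (lamt i + σ * Q.qCon i xt s (S i) xp
          + σ * ((inner ℝ (Q.gradG i xt s) w + inner ℝ (S i (xp - xt)) w) * θ
            + 1 / 2 * inner ℝ (S i w) w * θ ^ 2)) 0 ^ 2) := by
    intro θ
    have e : ∀ i, lamt i + σ * Q.qCon i xt s (S i) (xp + θ • w)
        = lamt i + σ * Q.qCon i xt s (S i) xp
          + σ * ((inner ℝ (Q.gradG i xt s) w + inner ℝ (S i (xp - xt)) w) * θ
            + 1 / 2 * inner ℝ (S i w) w * θ ^ 2) := by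
      intro i; rw [qCon_add Q i xt s (h.symm i)]; ring
    simp only [Problem.augLag, e]
    rw [qObj_add Q xt s hS₀, hnorm, hc₁, hc₂]
    ring
  have hobj0 : Q.augLag σ xt s (sigmaZero τ lamt S) S xp lamt + α / 2 * ‖xp - xt‖ ^ 2
      = (Q.qObj xt s (sigmaZero τ lamt S) xp + α / 2 * ‖xp - xt‖ ^ 2 - 1 / (2 * σ) * ‖lamt‖ ^ 2)
        + 1 / (2 * σ) * ∑ i, max (lamt i + σ * Q.qCon i xt s (S i) xp) 0 ^ 2 := by
    simp only [Problem.augLag]; ring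
  have hgrow := segment_growth hσ c₁ c₂ (fun i => lamt i + σ * Q.qCon i xt s (S i) xp)
    (fun i => inner ℝ (Q.gradG i xt s) w + inner ℝ (S i (xp - xt)) w)
    (fun i => 1 / 2 * inner ℝ (S i w) w) (by
      intro θ h0 h1
      have := h.argmin (hmem θ h0 h1)
      simp only [Set.mem_ofPred_eq] at this
      rw [hobj, hobj0] at this
      linarith)
  have hz1 : z = xp + (1 : ℝ) • w := by rw [hw, one_smul]; abel
  have hobj1 := hobj 1
  rw [← hz1] at hobj1
  rw [hobj1, hobj0]
  simp only [mul_one, one_pow]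
  simp only [← h.step_lam] at hgrow ⊢
  have hsum : 1 / 2 * ∑ i, (lamp i - lamt i) * inner ℝ (S i w) w
      = ∑ i, 1 / 2 * inner ℝ (S i w) w * lamp i - 1 / 2 * ∑ i, lamt i * inner ℝ (S i w) w := by
    rw [Finset.mul_sum, Finset.mul_sum, ← Finset.sum_sub_distrib]
    exact Finset.sum_congr rfl fun i _ => by ring
  have hc2' : c₂ = -(1 / 2 * ∑ i, lamt i * inner ℝ (S i w) w) + (τ + α) / 2 * ‖w‖ ^ 2 := by
    rw [hc₂, inner_sigmaZero, real_inner_self_eq_norm_sq]; ring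
  rw [hsum]
  linarith

/-- The growth inequality, with the augmented Lagrangian bounded above at z (`hup`) and below at the
new point (`hlow`). The value F(x^t,ξ_t) cancels. -/
theorem lyapunov (hQ : Q.Standing) (hc : c.Pos) (hA : Q.Assumptions c) (hσ : 0 < σ)
    (hατ : 0 ≤ τ + α) (hε : Real.sqrt p * c.κS * c.D₀ ^ 2 ≤ c.ε₀)
    (h : Q.IsStep c σ α τ xt lamt s S xp lamp) {z : Vec n} (hz : z ∈ Q.X₀) :
    ‖lamp‖ ^ 2 + σ * (τ + α) * ‖z - xp‖ ^ 2 ≤ ‖lamt‖ ^ 2 + σ * (τ + α) * ‖z - xt‖ ^ 2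
      + 2 * σ * (∑ i, lamt i * Q.G i z s + c.ε₀ / 2 * ‖lamt‖
        + (c.κf * c.D₀ + σ * c.ν ^ 2 / 2 + c.ε₀ * σ * c.ν / 2)) := by
  have hseg := h.segment hQ hσ hz
  have hGn : ∀ y ∈ Q.X₀, ∑ i, Q.G i y s ^ 2 ≤ c.ν ^ 2 := by
    intro y hy
    have h1 := hA.bound_G y (hQ.subset hy) s h.s_mem
    have h2 : ‖(WithLp.toLp 2 (fun i => Q.G i y s) : Vec p)‖ ^ 2 = ∑ i, Q.G i y s ^ 2 := by
      rw [EuclideanSpace.norm_sq_eq]; simp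
    rw [← h2]; gcongr
  -- The quadratic form is nonpositive, so only increases of a multiplier hurt, and each increase is
  -- at most σ|G_i|. The factor √p κ_Σ D₀² is absorbed by ε₀.
  have hcurv : -(c.ε₀ * σ * c.ν) ≤
      ∑ i, (lamp i - lamt i) * inner ℝ (S i (z - xp)) (z - xp) := by
    have h1 : ∀ i, -(σ * c.κS * c.D₀ ^ 2 * |Q.G i xp s|) ≤
        (lamp i - lamt i) * inner ℝ (S i (z - xp)) (z - xp) := by
      intro i
      have e1 : lamp i - lamt i ≤ σ * |Q.G i xp s| := by
        have hq := h.qCon_le hQ hA i h.xp_mem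
        have := mul_le_mul_of_nonneg_left (hq.trans (le_abs_self _)) hσ.le
        rw [h.step_lam i, sub_le_iff_le_add]
        refine max_le (by linarith) ?_
        have := h.lamt_nonneg i
        positivity
      have e2 := h.inner_nonpos hc i (z - xp)
      have e3 := h.neg_le_inner i (z - xp)
      have e4 := norm_sub_sq_le hA hz h.xp_mem
      have e5 := mul_le_mul_of_nonneg_left e4 hc.κS.le
      have e6 := mul_le_mul_of_nonpos_right e1 e2
      have e7 : 0 ≤ σ * |Q.G i xp s| := by positivity
      have e8 := mul_le_mul_of_nonneg_left
        (show -(c.κS * c.D₀ ^ 2) ≤ inner ℝ (S i (z - xp)) (z - xp) by linarith) e7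
      linarith
    have h2 : ∑ i, |Q.G i xp s| ≤ Real.sqrt p * c.ν := by
      have e1 := sum_abs_le_sqrt_mul_norm (WithLp.toLp 2 (fun i => Q.G i xp s) : Vec p)
      have e2 := hA.bound_G xp (hQ.subset h.xp_mem) s h.s_mem
      exact e1.trans (mul_le_mul_of_nonneg_left e2 (Real.sqrt_nonneg _))
    have h3 := Finset.sum_le_sum fun i (_ : i ∈ Finset.univ) => h1 i
    rw [Finset.sum_neg_distrib, ← Finset.mul_sum] at h3
    have h4 : 0 ≤ σ * c.κS * c.D₀ ^ 2 := by have := hc.κS; positivity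
    have h5 := mul_le_mul_of_nonneg_left h2 h4
    have h6 := mul_le_mul_of_nonneg_right hε (mul_nonneg hσ.le hc.ν.le)
    linarith
  have hup : Q.augLag σ xt s (sigmaZero τ lamt S) S z lamt ≤ Q.F xt s
      + inner ℝ (Q.gradF xt s) (z - xt) + c.ε₀ / 2 * ‖lamt‖ + τ / 2 * ‖z - xt‖ ^ 2
      + ∑ i, lamt i * Q.G i z s + σ * c.ν ^ 2 / 2 := by
    -- Half of this is the price of the term -∑ λ_i Σ_i at z: it uses up half of the Slater margin.
    have h1 : -(∑ i, lamt i * inner ℝ (S i (z - xt)) (z - xt)) ≤ c.ε₀ * ‖lamt‖ := by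
      have e1 : ∀ i, -(lamt i * inner ℝ (S i (z - xt)) (z - xt)) ≤ c.κS * c.D₀ ^ 2 * |lamt i| := by
        intro i
        have e4 := mul_le_mul_of_nonneg_left (norm_sub_sq_le hA hz h.xt_mem) hc.κS.le
        have e3 := h.neg_le_inner i (z - xt)
        have e5 := mul_le_mul_of_nonneg_left
          (show -inner ℝ (S i (z - xt)) (z - xt) ≤ c.κS * c.D₀ ^ 2 by linarith) (h.lamt_nonneg i)
        rw [abs_of_nonneg (h.lamt_nonneg i)]
        linarith
      rw [← Finset.sum_neg_distrib]
      refine (Finset.sum_le_sum fun i _ => e1 i).trans ?_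
      rw [← Finset.mul_sum]
      have h4 : 0 ≤ c.κS * c.D₀ ^ 2 := by have := hc.κS; positivity
      have h5 := mul_le_mul_of_nonneg_left (sum_abs_le_sqrt_mul_norm lamt) h4
      have h6 := mul_le_mul_of_nonneg_right hε (norm_nonneg lamt)
      linarith
    have h2 : ∑ i, max (lamt i + σ * Q.qCon i xt s (S i) z) 0 ^ 2 ≤
        ∑ i, (lamt i ^ 2 + 2 * σ * (lamt i * Q.G i z s) + σ ^ 2 * Q.G i z s ^ 2) := by
      refine Finset.sum_le_sum fun i _ => ?_
      have hq := mul_le_mul_of_nonneg_left (h.qCon_le hQ hA i hz) hσ.le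
      calc max (lamt i + σ * Q.qCon i xt s (S i) z) 0 ^ 2
          ≤ |lamt i + σ * Q.G i z s| ^ 2 := by
            apply pow_le_pow_left₀ (le_max_right _ _)
            exact max_le ((by linarith : lamt i + σ * Q.qCon i xt s (S i) z ≤
              lamt i + σ * Q.G i z s).trans (le_abs_self _)) (abs_nonneg _)
        _ = _ := by rw [sq_abs]; ring
    rw [Finset.sum_add_distrib, Finset.sum_add_distrib, ← Finset.mul_sum, ← Finset.mul_sum] at h2
    have h3 : ‖lamt‖ ^ 2 = ∑ i, lamt i ^ 2 := by rw [EuclideanSpace.norm_sq_eq]; simp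
    have h4 := mul_le_mul_of_nonneg_left (hGn z hz) (sq_nonneg σ)
    have h5 : 1 / (2 * σ) * (∑ i, max (lamt i + σ * Q.qCon i xt s (S i) z) 0 ^ 2 - ‖lamt‖ ^ 2)
        ≤ ∑ i, lamt i * Q.G i z s + σ * c.ν ^ 2 / 2 := by
      rw [one_div, inv_mul_le_iff₀ (by positivity)]
      rw [h3]
      linarith
    simp only [Problem.augLag, Problem.qObj]
    rw [inner_sigmaZero, real_inner_self_eq_norm_sq]
    linarith
  have hlow : Q.F xt s + inner ℝ (Q.gradF xt s) (xp - xt)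
      + 1 / (2 * σ) * (‖lamp‖ ^ 2 - ‖lamt‖ ^ 2) + τ / 2 * ‖xp - xt‖ ^ 2 ≤
      Q.augLag σ xt s (sigmaZero τ lamt S) S xp lamt := by
    have h1 : ∑ i, lamt i * inner ℝ (S i (xp - xt)) (xp - xt) ≤ 0 :=
      Finset.sum_nonpos fun i _ =>
        mul_nonpos_of_nonneg_of_nonpos (h.lamt_nonneg i) (h.inner_nonpos hc i _)
    have h3 : ‖lamp‖ ^ 2 = ∑ i, lamp i ^ 2 := by rw [EuclideanSpace.norm_sq_eq]; simp
    simp only [Problem.augLag, Problem.qObj, ← h.step_lam, ← h3]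
    rw [inner_sigmaZero, real_inner_self_eq_norm_sq]
    linarith
  have hgrad : inner ℝ (Q.gradF xt s) (z - xt) - inner ℝ (Q.gradF xt s) (xp - xt)
      ≤ c.κf * c.D₀ := by
    rw [← inner_sub_right]
    have e : z - xt - (xp - xt) = z - xp := by abel
    rw [e]
    refine (real_inner_le_norm _ _).trans ?_
    exact mul_le_mul (hA.bound_gradF xt (hQ.subset h.xt_mem) s h.s_mem)
      (hA.diam z hz xp h.xp_mem) (norm_nonneg _) hc.κf.le
  have hd : 0 ≤ (τ + α) / 2 * ‖xp - xt‖ ^ 2 := by positivity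
  have hfin : 1 / (2 * σ) * (‖lamp‖ ^ 2 - ‖lamt‖ ^ 2) ≤
      (τ + α) / 2 * ‖z - xt‖ ^ 2 - (τ + α) / 2 * ‖z - xp‖ ^ 2 + (∑ i, lamt i * Q.G i z s
        + c.ε₀ / 2 * ‖lamt‖ + (c.κf * c.D₀ + σ * c.ν ^ 2 / 2 + c.ε₀ * σ * c.ν / 2)) := by
    linarith
  rw [one_div, inv_mul_le_iff₀ (by positivity)] at hfin
  linarith

/-- Staying at x^t is feasible, so the proximal cost of moving is paid by a decrease of the
augmented Lagrangian, which is at most linear in ‖d‖. One factor ‖d‖ is then divided out. -/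
theorem norm_step_le (hQ : Q.Standing) (hc : c.Pos) (hA : Q.Assumptions c) (hσ : 0 < σ)
    (hτ : 0 ≤ τ) (h : Q.IsStep c σ α τ xt lamt s S xp lamp) :
    α / 2 * ‖xp - xt‖ ≤ c.κf
      + (c.κg + c.κS * c.D₀ / 2) * (Real.sqrt p * (‖lamt‖ + σ * c.ν)) := by
  set d := xp - xt with hd
  have hmin := h.argmin h.xt_mem
  simp only [Set.mem_ofPred_eq] at hmin
  have hq0 : ∀ i, Q.qCon i xt s (S i) xt = Q.G i xt s := by intro i; simp [Problem.qCon]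
  have hqd : ∀ i, Q.qCon i xt s (S i) xp
      = Q.G i xt s + (inner ℝ (Q.gradG i xt s) d + 1 / 2 * inner ℝ (S i d) d) := by
    intro i; simp [Problem.qCon, hd]; ring
  have hxt : Q.augLag σ xt s (sigmaZero τ lamt S) S xt lamt = Q.F xt s +
      1 / (2 * σ) * (∑ i, max (lamt i + σ * Q.G i xt s) 0 ^ 2 - ‖lamt‖ ^ 2) := by
    simp [Problem.augLag, Problem.qObj, hq0]
  have hsum : ∑ i, (max (lamt i + σ * Q.G i xt s) 0 ^ 2 + 2 * σ *
      ((inner ℝ (Q.gradG i xt s) d + 1 / 2 * inner ℝ (S i d) d)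
        * max (lamt i + σ * Q.G i xt s) 0)) ≤
      ∑ i, max (lamt i + σ * Q.qCon i xt s (S i) xp) 0 ^ 2 := by
    refine Finset.sum_le_sum fun i _ => ?_
    rw [hqd, mul_add, ← add_assoc]
    refine le_trans (le_of_eq ?_) (max_add_sq_ge _ _)
    ring
  rw [Finset.sum_add_distrib, ← Finset.mul_sum] at hsum
  have hxp : Q.F xt s + inner ℝ (Q.gradF xt s) d +
      1 / (2 * σ) * (∑ i, max (lamt i + σ * Q.qCon i xt s (S i) xp) 0 ^ 2 - ‖lamt‖ ^ 2) ≤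
      Q.augLag σ xt s (sigmaZero τ lamt S) S xp lamt := by
    have h1 : ∑ i, lamt i * inner ℝ (S i d) d ≤ 0 :=
      Finset.sum_nonpos fun i _ =>
        mul_nonpos_of_nonneg_of_nonpos (h.lamt_nonneg i) (h.inner_nonpos hc i _)
    have h2 : 0 ≤ τ * ‖d‖ ^ 2 := by positivity
    simp only [Problem.augLag, Problem.qObj, ← hd]
    rw [inner_sigmaZero, real_inner_self_eq_norm_sq]
    linarith
  have hterm : ∀ i, -((c.κg + c.κS * c.D₀ / 2) * ‖d‖ * (|lamt i| + σ * |Q.G i xt s|)) ≤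
      (inner ℝ (Q.gradG i xt s) d + 1 / 2 * inner ℝ (S i d) d)
        * max (lamt i + σ * Q.G i xt s) 0 := by
    intro i
    have e1 : -(c.κg * ‖d‖) ≤ inner ℝ (Q.gradG i xt s) d := by
      refine le_trans (neg_le_neg ?_) (neg_le_of_abs_le (abs_real_inner_le_norm _ _))
      exact mul_le_mul_of_nonneg_right (hA.bound_gradG i xt (hQ.subset h.xt_mem) s h.s_mem)
        (norm_nonneg _)
    have e2 := h.neg_le_inner i d
    have e3 : ‖d‖ ^ 2 ≤ c.D₀ * ‖d‖ := by
      rw [sq]; exact mul_le_mul_of_nonneg_right (hA.diam xp h.xp_mem xt h.xt_mem) (norm_nonneg _)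
    have e3' := mul_le_mul_of_nonneg_left e3 hc.κS.le
    have e4 : max (lamt i + σ * Q.G i xt s) 0 ≤ |lamt i| + σ * |Q.G i xt s| := by
      refine max_le (add_le_add (le_abs_self _) ?_) (by positivity)
      exact mul_le_mul_of_nonneg_left (le_abs_self _) hσ.le
    have e5 := mul_le_mul_of_nonneg_right (show -((c.κg + c.κS * c.D₀ / 2) * ‖d‖) ≤
      inner ℝ (Q.gradG i xt s) d + 1 / 2 * inner ℝ (S i d) d by linarith)
      (le_max_right (lamt i + σ * Q.G i xt s) 0)
    have e6 : 0 ≤ (c.κg + c.κS * c.D₀ / 2) * ‖d‖ := by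
      have := hc.κg; have := hc.κS; have := hc.D₀; positivity
    have e7 := mul_le_mul_of_nonneg_left e4 e6
    linarith
  have hS := Finset.sum_le_sum fun i (_ : i ∈ Finset.univ) => hterm i
  rw [Finset.sum_neg_distrib, ← Finset.mul_sum, Finset.sum_add_distrib, ← Finset.mul_sum] at hS
  have hl := sum_abs_le_sqrt_mul_norm lamt
  have hG : ∑ i, |Q.G i xt s| ≤ Real.sqrt p * c.ν := by
    have e1 := sum_abs_le_sqrt_mul_norm (WithLp.toLp 2 (fun i => Q.G i xt s) : Vec p)
    have e2 := hA.bound_G xt (hQ.subset h.xt_mem) s h.s_mem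
    exact e1.trans (mul_le_mul_of_nonneg_left e2 (Real.sqrt_nonneg _))
  have e6 : 0 ≤ (c.κg + c.κS * c.D₀ / 2) * ‖d‖ := by
    have := hc.κg; have := hc.κS; have := hc.D₀; positivity
  have hlG := mul_le_mul_of_nonneg_left
    (add_le_add hl (mul_le_mul_of_nonneg_left hG hσ.le)) e6
  have hgF : -(c.κf * ‖d‖) ≤ inner ℝ (Q.gradF xt s) d := by
    refine le_trans (neg_le_neg ?_) (neg_le_of_abs_le (abs_real_inner_le_norm _ _))
    exact mul_le_mul_of_nonneg_right (hA.bound_gradF xt (hQ.subset h.xt_mem) s h.s_mem)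
      (norm_nonneg _)
  set P := ∑ i, max (lamt i + σ * Q.G i xt s) 0 ^ 2
  set R := ∑ i, max (lamt i + σ * Q.qCon i xt s (S i) xp) 0 ^ 2
  set U := ∑ i, (inner ℝ (Q.gradG i xt s) d + 1 / 2 * inner ℝ (S i d) d)
        * max (lamt i + σ * Q.G i xt s) 0
  have hdiv : 1 / (2 * σ) * (P - ‖lamt‖ ^ 2) + U ≤ 1 / (2 * σ) * (R - ‖lamt‖ ^ 2) := by
    have e : 1 / (2 * σ) * (P - ‖lamt‖ ^ 2) + U
        = 1 / (2 * σ) * (P + 2 * σ * U - ‖lamt‖ ^ 2) := by field_simp; ring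
    rw [e]
    have : 0 ≤ 1 / (2 * σ) := by positivity
    exact mul_le_mul_of_nonneg_left (by linarith) this
  rw [hxt] at hmin
  have hz : α / 2 * ‖xt - xt‖ ^ 2 = 0 := by simp
  rw [hz] at hmin
  have hmain : ‖d‖ * (α / 2 * ‖d‖) ≤ ‖d‖ * (c.κf
      + (c.κg + c.κS * c.D₀ / 2) * (Real.sqrt p * (‖lamt‖ + σ * c.ν))) := by
    linarith
  rcases (norm_nonneg d).eq_or_lt with h0 | h0
  · rw [← h0]
    have := hc.κg; have := hc.κS; have := hc.D₀; have := hc.κf; have := hc.ν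
    simp only [mul_zero]
    positivity
  · exact le_of_mul_le_mul_left hmain h0

/-- The multiplier update bounds the model at the new point; returning to x^t costs a multiple of
the step length. Summed over t, the multiplier differences telescope. -/
theorem G_le (hQ : Q.Standing) (hc : c.Pos) (hA : Q.Assumptions c) (hσ : 0 < σ)
    (h : Q.IsStep c σ α τ xt lamt s S xp lamp) (i : Fin p) :
    Q.G i xt s ≤ (lamp i - lamt i) / σ + (c.κg + c.κS * c.D₀ / 2) * ‖xp - xt‖ := by
  have h1 : Q.qCon i xt s (S i) xp ≤ (lamp i - lamt i) / σ := by
    rw [le_div_iff₀ hσ, h.step_lam i]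
    linarith [le_max_left (lamt i + σ * Q.qCon i xt s (S i) xp) 0]
  have e1 : -(c.κg * ‖xp - xt‖) ≤ inner ℝ (Q.gradG i xt s) (xp - xt) := by
    refine le_trans (neg_le_neg ?_) (neg_le_of_abs_le (abs_real_inner_le_norm _ _))
    exact mul_le_mul_of_nonneg_right (hA.bound_gradG i xt (hQ.subset h.xt_mem) s h.s_mem)
      (norm_nonneg _)
  have e2 := h.neg_le_inner i (xp - xt)
  have e3 : ‖xp - xt‖ ^ 2 ≤ c.D₀ * ‖xp - xt‖ := by
    rw [sq]; exact mul_le_mul_of_nonneg_right (hA.diam xp h.xp_mem xt h.xt_mem) (norm_nonneg _)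
  have e3' := mul_le_mul_of_nonneg_left e3 hc.κS.le
  simp only [Problem.qCon] at h1
  linarith

end Problem.IsStep

end Vector

/-! ### Moment generating function bounds. -/

section ExpBound

/-- The linear term disappears after integrating a centred variable, leaving an exponential of a
square, which the light-tail assumption controls. -/
theorem exp_le_add_exp_sq (x : ℝ) : Real.exp x ≤ x + Real.exp (9 / 16 * x ^ 2) := by
  rcases le_or_gt x 0 with h | h
  · have h1 := Real.add_one_le_exp (9 / 16 * x ^ 2)
    have h2 : Real.exp x ≤ 1 + x + x ^ 2 / 2 := by
      have hq := Real.quadratic_le_exp_of_nonneg (x := -x) (by linarith)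
      have hp := Real.exp_pos (-x)
      have : Real.exp x * Real.exp (-x) = 1 := by rw [← Real.exp_add]; simp
      have hm : 1 ≤ (1 + x + x ^ 2 / 2) * (1 + -x + (-x) ^ 2 / 2) := by
        nlinarith [sq_nonneg (x ^ 2)]
      have hpos : 0 ≤ 1 + x + x ^ 2 / 2 := by nlinarith [sq_nonneg (x + 1)]
      have := mul_le_mul_of_nonneg_left hq hpos
      by_contra! hc
      have := mul_lt_mul_of_pos_right hc hp
      linarith
    nlinarith [sq_nonneg x]
  rcases le_or_gt x 1 with h1 | h1
  · have hb := Real.exp_bound' h.le h1 (n := 5) (by norm_num)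
    have hc := Real.sum_le_exp_of_nonneg (x := 9 / 16 * x ^ 2) (by positivity) 4
    simp [Finset.sum_range_succ, Nat.factorial] at hb hc
    nlinarith [sq_nonneg (x * (x - 2 / 3)), sq_nonneg (x * (x - 7 / 10)), sq_nonneg (x ^ 2),
      sq_nonneg (x * (x ^ 2 - 1 / 2)), mul_nonneg h.le (sq_nonneg (x ^ 2)),
      mul_nonneg (sq_nonneg x) (mul_nonneg h.le (sub_nonneg.2 h1)),
      mul_nonneg (sq_nonneg (x ^ 2)) (sub_nonneg.2 h1)]
  rcases le_or_gt (16 / 9) x with h2 | h2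
  · have : Real.exp x ≤ Real.exp (9 / 16 * x ^ 2) := Real.exp_le_exp.2 (by nlinarith)
    linarith
  -- On (1, 16/9), divide by e^x and bound e^{-x} and e^{9x²/16 - x} below by linearizing each
  -- exponential about its exponent at x = 1; these exponents are -1 and -7/16.
  · have a1 : 0.3678 ≤ Real.exp (-1) := by
      rw [Real.exp_neg, le_inv_comm₀ (by norm_num) (Real.exp_pos 1)]
      exact (Real.exp_one_lt_d9.le).trans (by norm_num)
    have a2 : 0.6375 ≤ Real.exp (-(7 / 16)) := by
      have e : Real.exp (-(7 / 16)) = Real.exp (-(7 / 128)) ^ 8 := by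
        rw [← Real.exp_nat_mul]; norm_num
      have h3 := Real.add_one_le_exp (-(7 / 128) : ℝ)
      rw [e]
      refine le_trans ?_ (pow_le_pow_left₀ (by norm_num) h3 8)
      norm_num
    have b1 : 0.3678 * (2 - x) ≤ Real.exp (-x) := by
      have e : Real.exp (-x) = Real.exp (-1) * Real.exp (1 - x) := by
        rw [← Real.exp_add]; ring_nf
      have h3 := Real.add_one_le_exp (1 - x)
      rw [e]
      exact mul_le_mul a1 (by linarith) (by linarith) (Real.exp_pos _).le
    have b2 : 0.6375 * (1 + (7 / 16 - x + 9 / 16 * x ^ 2)) ≤ Real.exp (9 / 16 * x ^ 2 - x) := by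
      have e : Real.exp (9 / 16 * x ^ 2 - x)
          = Real.exp (-(7 / 16)) * Real.exp (7 / 16 - x + 9 / 16 * x ^ 2) := by
        rw [← Real.exp_add]; ring_nf
      have h3 := Real.add_one_le_exp (7 / 16 - x + 9 / 16 * x ^ 2)
      rw [e]
      exact mul_le_mul a2 (by linarith) (by nlinarith) (Real.exp_pos _).le
    have b3 : 1 ≤ x * Real.exp (-x) + Real.exp (9 / 16 * x ^ 2 - x) := by
      have := mul_le_mul_of_nonneg_left b1 h.le
      nlinarith
    have b4 := mul_le_mul_of_nonneg_left b3 (Real.exp_pos x).le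
    have c1 : Real.exp x * Real.exp (-x) = 1 := by rw [← Real.exp_add]; simp
    have c2 : Real.exp x * Real.exp (9 / 16 * x ^ 2 - x) = Real.exp (9 / 16 * x ^ 2) := by
      rw [← Real.exp_add]; ring_nf
    linear_combination b4 + x * c1 + c2

/-- Pointwise form of Jensen's inequality: if E e^u ≤ e, integrating gives E e^{θu} ≤ e^θ. -/
theorem exp_mul_le {θ : ℝ} (h0 : 0 ≤ θ) (h1 : θ ≤ 1) (u : ℝ) :
    Real.exp (θ * u) ≤ Real.exp θ * (θ * (Real.exp (-1) * Real.exp u) + (1 - θ)) := by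
  have := convexOn_exp.2 (Set.mem_univ (u - 1)) (Set.mem_univ 0) h0 (sub_nonneg.2 h1)
    (by ring)
  simp only [smul_eq_mul, mul_zero, add_zero, Real.exp_zero, mul_one] at this
  have e : θ * u = θ + θ * (u - 1) := by ring
  rw [e, Real.exp_add, ← Real.exp_add (-1) u, neg_add_eq_sub]
  exact mul_le_mul_of_nonneg_left this (Real.exp_pos _).le

variable {Ω : Type*} [MeasurableSpace Ω] {μ : Measure Ω} [IsProbabilityMeasure μ]

/-- For small γρ, `exp_le_add_exp_sq` and the zero mean suffice; for large γρ, Young's inequality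
does, without centring. -/
theorem lintegral_exp_le_of_lightTail {X : Ω → ℝ} {ρ γ : ℝ} (hX : Integrable X μ)
    (hX0 : ∫ ω, X ω ∂μ = 0) (hρ : 0 < ρ)
    (hint : Integrable (fun ω => Real.exp (X ω ^ 2 / ρ ^ 2)) μ)
    (hle : ∫ ω, Real.exp (X ω ^ 2 / ρ ^ 2) ∂μ ≤ Real.exp 1) :
    ∫⁻ ω, ENNReal.ofReal (Real.exp (γ * X ω)) ∂μ
      ≤ ENNReal.ofReal (Real.exp (3 / 4 * (γ * ρ) ^ 2)) := by
  have key : ∀ θ a : ℝ, ∀ k : ℝ, 0 ≤ θ → θ ≤ 1 → 0 ≤ k →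
      (∀ x : ℝ, Real.exp (γ * x) ≤ a * x + k * Real.exp (θ * (x ^ 2 / ρ ^ 2))) →
      ∫⁻ ω, ENNReal.ofReal (Real.exp (γ * X ω)) ∂μ ≤ ENNReal.ofReal (k * Real.exp θ) := by
    intro θ a k h0 h1 hk hb
    set B : Ω → ℝ := fun ω => a * X ω + k * (Real.exp θ * (θ * (Real.exp (-1)
      * Real.exp (X ω ^ 2 / ρ ^ 2)) + (1 - θ))) with hB
    have hle' : ∀ ω, Real.exp (γ * X ω) ≤ B ω := fun ω => (hb (X ω)).trans
      (add_le_add le_rfl (mul_le_mul_of_nonneg_left (exp_mul_le h0 h1 _) hk))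
    have hi2 : Integrable (fun ω => k * (Real.exp θ * (θ * (Real.exp (-1)
      * Real.exp (X ω ^ 2 / ρ ^ 2)) + (1 - θ)))) μ :=
      ((((hint.const_mul _).const_mul _).add (integrable_const _)).const_mul _).const_mul _
    have hBi : Integrable B μ := (hX.const_mul _).add hi2
    calc ∫⁻ ω, ENNReal.ofReal (Real.exp (γ * X ω)) ∂μ
        ≤ ∫⁻ ω, ENNReal.ofReal (B ω) ∂μ :=
          lintegral_mono fun ω => ENNReal.ofReal_le_ofReal (hle' ω)
      _ = ENNReal.ofReal (∫ ω, B ω ∂μ) :=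
          (ofReal_integral_eq_lintegral_ofReal hBi
            (ae_of_all _ fun ω => (Real.exp_pos _).le.trans (hle' ω))).symm
      _ ≤ ENNReal.ofReal (k * Real.exp θ) := by
          apply ENNReal.ofReal_le_ofReal
          rw [hB, integral_add (hX.const_mul _) hi2, integral_const_mul, hX0,
            integral_const_mul, integral_const_mul,
            integral_add ((hint.const_mul _).const_mul _) (integrable_const _),
            integral_const_mul, integral_const_mul]
          simp only [mul_zero, zero_add, integral_const, probReal_univ, one_smul]
          have h2 : Real.exp (-1) * ∫ ω, Real.exp (X ω ^ 2 / ρ ^ 2) ∂μ ≤ 1 := by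
            calc _ ≤ Real.exp (-1) * Real.exp 1 :=
                  mul_le_mul_of_nonneg_left hle (Real.exp_pos _).le
              _ = 1 := by rw [← Real.exp_add]; simp
          have h3 := mul_le_mul_of_nonneg_left h2 h0
          have h4 := mul_le_mul_of_nonneg_left
            (show θ * (Real.exp (-1) * ∫ ω, Real.exp (X ω ^ 2 / ρ ^ 2) ∂μ) + (1 - θ) ≤ 1 by
              linarith) (Real.exp_pos θ).le
          rw [mul_one] at h4
          exact mul_le_mul_of_nonneg_left h4 hk
  rcases le_or_gt (9 / 16 * (γ * ρ) ^ 2) 1 with h | h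
  · refine (key (9 / 16 * (γ * ρ) ^ 2) γ 1 (by positivity) h zero_le_one ?_).trans ?_
    · intro x
      have := exp_le_add_exp_sq (γ * x)
      have e : 9 / 16 * (γ * ρ) ^ 2 * (x ^ 2 / ρ ^ 2) = 9 / 16 * (γ * x) ^ 2 := by field_simp
      rw [e, one_mul]
      exact this
    · apply ENNReal.ofReal_le_ofReal
      rw [one_mul]
      apply Real.exp_le_exp.2
      have := sq_nonneg (γ * ρ)
      linarith
  -- Young: γx ≤ (3/8)(γρ)² + (2/3)(x/ρ)². In this regime (γρ)² > 16/9, so the leftover 2/3 is at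
  -- most another (3/8)(γρ)².
  · refine (key (2 / 3) 0 (Real.exp (3 / 8 * (γ * ρ) ^ 2)) (by norm_num) (by norm_num)
      (Real.exp_pos _).le ?_).trans ?_
    · intro x
      rw [zero_mul, zero_add, ← Real.exp_add]
      apply Real.exp_le_exp.2
      have e : γ * x = (γ * ρ) * (x / ρ) := by field_simp
      rw [e, ← div_pow]
      nlinarith [sq_nonneg (3 * (γ * ρ) - 4 * (x / ρ))]
    · apply ENNReal.ofReal_le_ofReal
      rw [← Real.exp_add]
      apply Real.exp_le_exp.2
      linarith

/-- Hoeffding's lemma on [-ν, ν]. An upper bound on the mean is enough because r ≥ 0. -/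
theorem lintegral_exp_le_of_bounded {X : Ω → ℝ} {ν m r : ℝ} (hX : AEMeasurable X μ)
    (hb : ∀ᵐ ω ∂μ, |X ω| ≤ ν) (hm : ∫ ω, X ω ∂μ ≤ m) (hr : 0 ≤ r) :
    ∫⁻ ω, ENNReal.ofReal (Real.exp (r * X ω)) ∂μ
      ≤ ENNReal.ofReal (Real.exp (r * m + r ^ 2 * ν ^ 2 / 2)) := by
  have hb' : ∀ᵐ ω ∂μ, X ω ∈ Set.Icc (-ν) ν := by
    filter_upwards [hb] with ω h using abs_le.1 h
  have h1 := hasSubgaussianMGF_of_mem_Icc hX hb'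
  have h2 := h1.mgf_le r
  rw [← ofReal_integral_eq_lintegral_ofReal (integrable_exp_mul_of_mem_Icc hX hb')
    (ae_of_all _ fun ω => (Real.exp_pos _).le)]
  apply ENNReal.ofReal_le_ofReal
  have e : ∀ ω, Real.exp (r * X ω)
      = Real.exp (r * ∫ ω, X ω ∂μ) * Real.exp (r * (X ω - ∫ ω, X ω ∂μ)) := by
    intro ω; rw [← Real.exp_add]; ring_nf
  simp only [mgf] at h2
  simp_rw [e]
  rw [integral_const_mul, Real.exp_add]
  refine mul_le_mul (Real.exp_le_exp.2 (mul_le_mul_of_nonneg_left hm hr)) (h2.trans ?_)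
    (integral_nonneg fun ω => (Real.exp_pos _).le) (Real.exp_pos _).le
  apply Real.exp_le_exp.2
  have hn : ((‖ν - -ν‖₊ / 2) ^ 2 : NNReal) = (ν ^ 2 : ℝ) := by
    push_cast
    rw [Real.norm_eq_abs, div_pow, sq_abs]; ring
  rw [hn]
  linarith

end ExpBound

/-! ### Independence of past and present, and exponential moments along the sample. -/

section Sampling

variable {n p q : ℕ}

theorem history_mono {Ω : Type*} (ξ : ℕ → Ω → Vec q) {s t : ℕ} (h : s ≤ t) : history ξ s ≤ history ξ t :=
  biSup_mono fun _ hk => ⟨hk.1, hk.2.trans_le h⟩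

theorem measurable_history {Ω : Type*} (ξ : ℕ → Ω → Vec q) {s t : ℕ} (hs : 1 ≤ s) (h : s < t) :
    Measurable[history ξ t] (ξ s) := by
  rw [measurable_iff_comap_le]
  exact le_iSup₂_of_le s ⟨hs, h⟩ le_rfl

namespace Problem.IsIIDSample

variable {Ω : Type*} [MeasurableSpace Ω] {Pr : Measure Ω} {Q : Problem n p q} {ξ : ℕ → Ω → Vec q}

theorem history_le (h : Q.IsIIDSample Pr ξ) (t : ℕ) : history ξ t ≤ ‹MeasurableSpace Ω› :=
  iSup₂_le fun k hk => (h.meas k hk.1).comap_le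

theorem indepFun (h : Q.IsIIDSample Pr ξ) {t : ℕ} (ht : 1 ≤ t) {A : Type*} [MeasurableSpace A]
    {X : Ω → A} (hX : Measurable[history ξ t] X) : IndepFun X (ξ t) Pr := by
  have h1 : iIndep (fun j : ℕ => MeasurableSpace.comap (ξ (j + 1)) inferInstance) Pr := h.indep
  -- The independent family starts at index 0, so ξ_t has index t - 1 and the history consists of
  -- the indices j with j + 1 < t.
  have h2 := indep_iSup_of_disjoint (fun j => (h.meas (j + 1) (by omega)).comap_le) h1
    (S := {j | j + 1 < t}) (T := {t - 1}) (by
      rw [Set.disjoint_singleton_right]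
      show ¬ (t - 1 + 1 < t)
      omega)
  rw [IndepFun_iff_Indep]
  refine indep_of_indep_of_le_left (indep_of_indep_of_le_right h2 ?_) (hX.comap_le.trans ?_)
  · refine le_iSup₂_of_le (t - 1) rfl ?_
    rw [Nat.sub_add_cancel ht]
  · refine iSup₂_le fun k hk => ?_
    have e : k - 1 + 1 = k := Nat.sub_add_cancel hk.1
    refine le_iSup₂_of_le (k - 1) (show k - 1 + 1 < t by rw [e]; exact hk.2) ?_
    rw [e]

/-- Fubini for a function of the past and of the current sample. -/
theorem lintegral_eq [IsProbabilityMeasure Pr] (h : Q.IsIIDSample Pr ξ) [SFinite Q.law] {t : ℕ} (ht : 1 ≤ t) {A : Type*}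
    [MeasurableSpace A] {X : Ω → A} (hX : Measurable[history ξ t] X) {H : A × Vec q → ENNReal}
    (hH : Measurable H) :
    ∫⁻ ω, H (X ω, ξ t ω) ∂Pr = ∫⁻ ω, ∫⁻ s, H (X ω, s) ∂Q.law ∂Pr := by
  have hX' : Measurable X := hX.mono (h.history_le t) le_rfl
  have hm := h.meas t ht
  have hprod := (indepFun_iff_map_prod_eq_prod_map_map hX'.aemeasurable hm.aemeasurable).1
    (h.indepFun ht hX)
  rw [h.law t ht] at hprod
  have : IsProbabilityMeasure (Pr.map X) := Measure.isProbabilityMeasure_map hX'.aemeasurable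
  rw [← lintegral_map (f := H) (g := fun ω => (X ω, ξ t ω)) hH (hX'.prodMk hm), hprod,
    lintegral_prod _ hH.aemeasurable,
    lintegral_map (f := fun a => ∫⁻ s, H (a, s) ∂Q.law) hH.lintegral_prod_right' hX']

theorem ae_comp (h : Q.IsIIDSample Pr ξ) {t : ℕ} (ht : 1 ≤ t) {P : Vec q → Prop}
    (hP : ∀ᵐ s ∂Q.law, P s) : ∀ᵐ ω ∂Pr, P (ξ t ω) := by
  rw [← h.law t ht] at hP
  exact ae_of_ae_map (h.meas t ht).aemeasurable hP

/-- Since the bound `hfK` is uniform in the state, Fubini peels off the last sample and no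
conditional expectation is needed. -/
theorem lintegral_exp_sum_le [IsProbabilityMeasure Pr] (h : Q.IsIIDSample Pr ξ) [SFinite Q.law] {A : Type*}
    [MeasurableSpace A] {T : ℕ} {X : ℕ → Ω → A}
    (hX : ∀ t ∈ Finset.Icc 1 T, Measurable[history ξ t] (X t))
    {f : A × Vec q → ℝ} (hf : Measurable f) {γ K : ℝ} (hK : 0 ≤ K)
    (hfK : ∀ a, ∫⁻ s, ENNReal.ofReal (Real.exp (γ * f (a, s))) ∂Q.law ≤ ENNReal.ofReal K)
    (k : ℕ) (hk : k ≤ T) :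
    ∫⁻ ω, ENNReal.ofReal (Real.exp (γ * ∑ t ∈ Finset.Icc 1 k, f (X t ω, ξ t ω))) ∂Pr
      ≤ ENNReal.ofReal (K ^ k) := by
  induction k with
  | zero => simp
  | succ k ih =>
    have ih := ih (by omega)
    have hS : Measurable[history ξ (k + 1)]
        (fun ω => ∑ t ∈ Finset.Icc 1 k, f (X t ω, ξ t ω)) := by
      refine Finset.measurable_fun_sum _ fun t ht => ?_
      rw [Finset.mem_Icc] at ht
      refine hf.comp (Measurable.prodMk (m := history ξ (k + 1)) ?_ ?_)
      · exact (hX t (Finset.mem_Icc.2 ⟨ht.1, by omega⟩)).mono (history_mono ξ (by omega)) le_rfl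
      · exact measurable_history ξ ht.1 (by omega)
    have hX1 := hX (k + 1) (Finset.mem_Icc.2 ⟨by omega, hk⟩)
    have hSX : Measurable[history ξ (k + 1)]
        (fun ω => ((∑ t ∈ Finset.Icc 1 k, f (X t ω, ξ t ω)), X (k + 1) ω)) :=
      Measurable.prodMk (m := history ξ (k + 1)) hS hX1
    have hH : Measurable (fun z : (ℝ × A) × Vec q =>
        ENNReal.ofReal (Real.exp (γ * z.1.1)) * ENNReal.ofReal (Real.exp (γ * f (z.1.2, z.2)))) := by
      fun_prop
    have hfr := h.lintegral_eq (by omega) hSX hH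
    calc ∫⁻ ω, ENNReal.ofReal (Real.exp (γ * ∑ t ∈ Finset.Icc 1 (k + 1), f (X t ω, ξ t ω))) ∂Pr
        = ∫⁻ ω, ENNReal.ofReal (Real.exp (γ * ∑ t ∈ Finset.Icc 1 k, f (X t ω, ξ t ω))) *
            ENNReal.ofReal (Real.exp (γ * f (X (k + 1) ω, ξ (k + 1) ω))) ∂Pr := by
          refine lintegral_congr fun ω => ?_
          rw [← ENNReal.ofReal_mul (Real.exp_pos _).le, ← Real.exp_add, ← mul_add,
            ← Finset.sum_Icc_succ_top (by omega)]
      _ = _ := hfr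
      _ ≤ ∫⁻ ω, ENNReal.ofReal (Real.exp (γ * ∑ t ∈ Finset.Icc 1 k, f (X t ω, ξ t ω)))
            * ENNReal.ofReal K ∂Pr := by
          refine lintegral_mono fun ω => ?_
          simp only
          rw [lintegral_const_mul' _ _ ENNReal.ofReal_ne_top]
          gcongr
          exact hfK _
      _ ≤ ENNReal.ofReal (K ^ k) * ENNReal.ofReal K := by
          rw [lintegral_mul_const' _ _ ENNReal.ofReal_ne_top]
          gcongr
      _ = ENNReal.ofReal (K ^ (k + 1)) := by
          rw [← ENNReal.ofReal_mul (by positivity), pow_succ]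

/-- One-step exponential drift. -/
theorem lintegral_exp_drift [IsProbabilityMeasure Pr] (h : Q.IsIIDSample Pr ξ) [IsProbabilityMeasure Q.law] {t : ℕ}
    (ht : 1 ≤ t) {lam : Ω → Vec p} {V V' : Ω → ℝ} (hlam : Measurable[history ξ t] lam)
    (hV : Measurable[history ξ t] V) {Y : Vec q → Vec p} (hY : Measurable Y)
    {ν ε σ C θ : ℝ} (hε : 0 < ε) (hεν : ε ≤ ν) (hσ : 0 < σ) (hθ : 0 < θ) (hC : 4 * C ≤ ε * θ)
    (hC0 : 0 ≤ C)
    (hYν : ∀ᵐ s ∂Q.law, ‖Y s‖ ≤ ν) (hYε : ∀ i, ∫ s, Y s i ∂Q.law ≤ -ε)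
    (hpos : ∀ᵐ ω ∂Pr, (∀ i, 0 ≤ lam ω i) ∧ ‖lam ω‖ ≤ V ω ∧ (θ ≤ V ω → 3 / 4 * V ω ≤ ‖lam ω‖))
    (hstep : ∀ᵐ ω ∂Pr, V' ω ^ 2 ≤ V ω ^ 2
      + 2 * σ * (∑ i, lam ω i * Y (ξ t ω) i + ε / 2 * ‖lam ω‖ + C)) :
    ∫⁻ ω, ENNReal.ofReal (Real.exp (ε / (4 * σ * ν ^ 2) * V' ω)) ∂Pr ≤
      ∫⁻ ω, ENNReal.ofReal (Real.exp (ε / (4 * σ * ν ^ 2) * V ω)) ∂Pr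
        + ENNReal.ofReal (Real.exp (ε / (4 * σ * ν ^ 2) * (θ + 5 / 2 * σ * ν))) := by
  have hν : 0 < ν := hε.trans_le hεν
  set r := ε / (4 * σ * ν ^ 2) with hr
  have hr0 : 0 < r := by positivity
  have hin : ∀ (l y : Vec p), |∑ i, l i * y i| ≤ ‖l‖ * ‖y‖ := by
    intro l y
    have := abs_real_inner_le_norm l y
    simpa [PiLp.inner_apply, mul_comm] using this
  have hlV : Measurable[history ξ t] (fun ω => (lam ω, V ω)) :=
    Measurable.prodMk (m := history ξ t) hlam hV
  -- A majorant of exp(r V') depending only on the past state and the current sample, so that Fubini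
  -- applies even though V' need not have this form.
  set H : (Vec p × ℝ) × Vec q → ENNReal := fun z => if θ ≤ z.1.2 then
    ENNReal.ofReal (Real.exp (r * (z.1.2 + σ * (∑ i, z.1.1 i * Y z.2 i + ε / 2 * ‖z.1.1‖ + C)
      / z.1.2))) else ENNReal.ofReal (Real.exp (r * (θ + 5 / 2 * σ * ν))) with hHdef
  have hH : Measurable H := by
    refine Measurable.ite (measurableSet_le measurable_const (by fun_prop)) ?_ measurable_const
    fun_prop
  have hfr := h.lintegral_eq ht hlV hH
  calc ∫⁻ ω, ENNReal.ofReal (Real.exp (r * V' ω)) ∂Pr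
      ≤ ∫⁻ ω, H ((lam ω, V ω), ξ t ω) ∂Pr := by
        refine lintegral_mono_ae ?_
        filter_upwards [hpos, hstep, h.ae_comp ht hYν] with ω ⟨h1, h2, h3⟩ h4 h5
        have h6 := le_of_abs_le (hin (lam ω) (Y (ξ t ω)))
        simp only [hHdef]
        set D := ∑ i, lam ω i * Y (ξ t ω) i + ε / 2 * ‖lam ω‖ + C with hD
        have h7 : ‖lam ω‖ * ‖Y (ξ t ω)‖ ≤ ‖lam ω‖ * ν :=
          mul_le_mul_of_nonneg_left h5 (norm_nonneg _)
        split_ifs with hc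
        · apply ENNReal.ofReal_le_ofReal
          apply Real.exp_le_exp.2
          apply mul_le_mul_of_nonneg_left _ hr0.le
          have hVpos : 0 < V ω := hθ.trans_le hc
          -- From V'² ≤ V² + 2σD and 2VV' ≤ V² + V'² follows V' ≤ V + σD/V, which is linear in the
          -- sample.
          have e1 : V ω + σ * D / V ω = (V ω ^ 2 + σ * D) / V ω := by field_simp
          rw [e1, le_div_iff₀ hVpos]
          linarith [sq_nonneg (V' ω - V ω)]
        · push Not at hc
          apply ENNReal.ofReal_le_ofReal
          apply Real.exp_le_exp.2
          apply mul_le_mul_of_nonneg_left _ hr0.le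
          have e0 : 0 ≤ 5 / 2 * σ * ν := by positivity
          have hl := norm_nonneg (lam ω)
          have hlθ : ‖lam ω‖ ≤ θ := h2.trans hc.le
          have e1 : D ≤ θ * (5 / 2 * ν) := by
            have a1 : ‖lam ω‖ * ν ≤ θ * ν := mul_le_mul_of_nonneg_right hlθ hν.le
            have a2 : ε / 2 * ‖lam ω‖ ≤ ν / 2 * θ := mul_le_mul (by linarith) hlθ hl (by linarith)
            have a3 : ε * θ ≤ ν * θ := mul_le_mul_of_nonneg_right hεν hθ.le
            have a4 : 0 ≤ ν * θ := by positivity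
            rw [hD]
            linarith
          have e2 := mul_le_mul_of_nonneg_left e1 hσ.le
          have e3 : V ω ^ 2 ≤ θ ^ 2 := pow_le_pow_left₀ (hl.trans h2) hc.le 2
          refine le_of_sq_le_sq ?_ ?_
          · nlinarith [sq_nonneg (5 / 2 * σ * ν)]
          · linarith
    _ = ∫⁻ ω, ∫⁻ s, H ((lam ω, V ω), s) ∂Q.law ∂Pr := hfr
    _ ≤ ∫⁻ ω, (ENNReal.ofReal (Real.exp (r * V ω))
          + ENNReal.ofReal (Real.exp (r * (θ + 5 / 2 * σ * ν)))) ∂Pr := by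
        refine lintegral_mono_ae ?_
        filter_upwards [hpos] with ω ⟨h1, h2, h3⟩
        simp only [hHdef]
        split_ifs with hc
        · refine le_trans ?_ le_self_add
          have hVpos : 0 < V ω := hθ.trans_le hc
          have h3 := h3 hc
          set L := lam ω with hL
          set v := V ω with hv
          have e1 : ∀ s, ENNReal.ofReal (Real.exp (r * (v + σ * (∑ i, L i * Y s i
              + ε / 2 * ‖L‖ + C) / v))) = ENNReal.ofReal (Real.exp (r * (v + σ * (ε / 2 * ‖L‖ + C)
              / v))) * ENNReal.ofReal (Real.exp (r * σ / v * ∑ i, L i * Y s i)) := by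
            intro s
            rw [← ENNReal.ofReal_mul (Real.exp_pos _).le, ← Real.exp_add]
            congr 2
            field_simp
            ring
          simp_rw [e1]
          rw [lintegral_const_mul' _ _ ENNReal.ofReal_ne_top]
          have hYi : ∀ i, Integrable (fun s => Y s i) Q.law := by
            intro i
            refine Integrable.of_bound (by fun_prop) ν ?_
            filter_upwards [hYν] with s hs
            exact (PiLp.norm_apply_le (Y s) i).trans hs
          have hmean : ∫ s, ∑ i, L i * Y s i ∂Q.law ≤ -(ε * ‖L‖) := by
            rw [integral_finsetSum _ fun i _ => (hYi i).const_mul _]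
            simp_rw [integral_const_mul]
            calc ∑ i, L i * ∫ s, Y s i ∂Q.law ≤ ∑ i, L i * (-ε) :=
                  Finset.sum_le_sum fun i _ => mul_le_mul_of_nonneg_left (hYε i) (h1 i)
              _ = -(ε * ∑ i, L i) := by rw [← Finset.sum_mul]; ring
              _ ≤ -(ε * ‖L‖) := by
                  have : ‖L‖ ≤ ∑ i, L i := by
                    rw [EuclideanSpace.norm_eq]
                    apply Real.sqrt_le_iff.2
                    refine ⟨Finset.sum_nonneg fun i _ => h1 i, ?_⟩
                    have := Finset.sum_sq_le_sq_sum_of_nonneg (s := Finset.univ) (f := fun i => L i)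
                      fun i _ => h1 i
                    simpa using this
                  have := mul_le_mul_of_nonneg_left this hε.le
                  linarith
          have hbd : ∀ᵐ s ∂Q.law, |∑ i, L i * Y s i| ≤ v * ν := by
            filter_upwards [hYν] with s hs
            exact (hin L (Y s)).trans (mul_le_mul h2 hs (norm_nonneg _) hVpos.le)
          have hhoef := lintegral_exp_le_of_bounded (μ := Q.law) (r := r * σ / v)
            (by fun_prop) hbd hmean (by positivity)
          refine (mul_le_mul_right hhoef _).trans ?_
          rw [← ENNReal.ofReal_mul (Real.exp_pos _).le, ← Real.exp_add]
          apply ENNReal.ofReal_le_ofReal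
          apply Real.exp_le_exp.2
          have e2 : r * (v + σ * (ε / 2 * ‖L‖ + C) / v) + (r * σ / v * -(ε * ‖L‖)
              + (r * σ / v) ^ 2 * (v * ν) ^ 2 / 2)
              = r * v + r * σ / v * (C - ε / 2 * ‖L‖ + ε / 8 * v) := by
            have : r * σ * ν ^ 2 = ε / 4 := by rw [hr]; field_simp
            have e3 : (r * σ / v) ^ 2 * (v * ν) ^ 2 / 2 = r * σ * (r * σ * ν ^ 2) / 2 := by
              field_simp
            rw [e3, this]
            field_simp
            ring
          rw [e2]
          -- The choice of `r` makes the Hoeffding term (ε/8)v. With C ≤ (ε/4)v and ‖L‖ ≥ (3/4)v the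
          -- coefficients 1/4 - 3/8 + 1/8 balance exactly.
          have e4 : C - ε / 2 * ‖L‖ + ε / 8 * v ≤ 0 := by
            have a1 := mul_le_mul_of_nonneg_left h3 hε.le
            have a2 := mul_le_mul_of_nonneg_left hc hε.le
            linarith
          have e5 : 0 ≤ r * σ / v := by positivity
          linarith [mul_nonpos_of_nonneg_of_nonpos e5 e4]
        · simp
    _ = _ := by
        rw [lintegral_add_right _ measurable_const]
        simp

end Problem.IsIIDSample

/-- A Carathéodory function agrees on `X₀` with a jointly measurable function. -/
theorem exists_measurable_eq_of_continuousOn {μ : Measure (Vec q)} {X₀ : Set (Vec n)}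
    (hX₀ : MeasurableSet X₀) {u : Vec n → Vec q → ℝ}
    (hm : ∀ x ∈ X₀, AEStronglyMeasurable (u x) μ)
    (hc : ∀ᵐ s ∂μ, ContinuousOn (fun x => u x s) X₀) :
    ∃ f : Vec n × Vec q → ℝ, Measurable f ∧ (∀ᵐ s ∂μ, ∀ x ∈ X₀, f (x, s) = u x s) ∧
      ∀ x ∉ X₀, ∀ s, f (x, s) = 0 := by
  -- Each section is measurable only up to a null set depending on x. A countable dense set leaves a
  -- single null set N; continuity in x recovers all other sections off N.
  obtain ⟨D, hDc, hD⟩ := TopologicalSpace.exists_countable_dense X₀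
  have hae : ∀ᵐ s ∂μ, ContinuousOn (fun x => u x s) X₀ ∧
      ∀ d ∈ D, u (d : Vec n) s = (hm d d.2).mk _ s := by
    refine hc.and ?_
    rw [ae_ball_iff hDc]
    intro d _
    exact (hm d d.2).ae_eq_mk
  obtain ⟨N, hN, hNm, hN0⟩ := exists_measurable_superset_of_null hae
  have hgood : ∀ s ∉ N, ContinuousOn (fun x => u x s) X₀ ∧
      ∀ d ∈ D, u (d : Vec n) s = (hm d d.2).mk _ s := by
    intro s hs
    by_contra h
    exact hs (hN h)
  classical
  set v : X₀ → Vec q → ℝ := fun x s => if s ∈ N then 0 else u x s with hv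
  have hvc : ∀ s, Continuous fun x => v x s := by
    intro s
    by_cases hs : s ∈ N
    · simp only [hv, hs, if_true]; exact continuous_const
    · simp only [hv, hs, if_false]
      exact continuousOn_iff_continuous_domRestrict.1 (hgood s hs).1
  have hvm : ∀ x, Measurable (v x) := by
    intro x
    obtain ⟨d, hdD, hdx⟩ := mem_closure_iff_seq_limit.1 (hD x)
    refine measurable_of_tendsto_metrizable (f := fun k => v (d k)) (fun k => ?_) ?_
    · have : v (d k) = fun s => if s ∈ N then 0 else (hm (d k) (d k).2).mk _ s := by
        funext s
        by_cases hs : s ∈ N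
        · simp [hv, hs]
        · simp only [hv, hs, if_false]; exact (hgood s hs).2 _ (hdD k)
      rw [this]
      exact Measurable.ite hNm measurable_const (hm (d k) (d k).2).stronglyMeasurable_mk.measurable
    · rw [tendsto_pi_nhds]
      intro s
      exact ((hvc s).tendsto x).comp hdx
  have hun := measurable_uncurry_of_continuous_of_measurable hvc hvm
  have he : MeasurableEmbedding (Prod.map Subtype.val id : X₀ × Vec q → Vec n × Vec q) :=
    (MeasurableEmbedding.subtype_coe hX₀).prodMap .id
  refine ⟨Function.extend (Prod.map Subtype.val id) (Function.uncurry v) 0,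
    he.measurable_extend hun measurable_const, ?_, ?_⟩
  · have : ∀ᵐ s ∂μ, s ∉ N := measure_eq_zero_iff_ae_notMem.1 hN0
    filter_upwards [this] with s hs x hx
    have := he.injective.extend_apply (Function.uncurry v) 0 (⟨x, hx⟩, s)
    refine this.trans ?_
    simp [hv, hs]
  · intro x hx s
    refine Function.extend_apply' _ _ _ ?_
    rintro ⟨⟨y, s'⟩, hy⟩
    have hyx : (y : Vec n) = x := congrArg Prod.fst hy
    exact hx (hyx ▸ y.2)

end Sampling

/-! ### Deterministic bounds along a sample path. -/

section Pathwise

variable {n p q : ℕ} {Q : Problem n p q} {c : Constants p} {σ α τ : ℝ} {T : ℕ} {x₁ : Vec n}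
  {z : ℕ → Vec q} {S : ℕ → Fin p → Op n} {x : ℕ → Vec n} {lam : ℕ → Vec p}

theorem Problem.IsPath.state_mem (h : Q.IsPath σ α τ T x₁ z S x lam) (hx₁ : x₁ ∈ Q.X₀) {t : ℕ}
    (ht : t ∈ Finset.Icc 1 (T + 1)) : x t ∈ Q.X₀ ∧ ∀ i, 0 ≤ lam t i := by
  rw [Finset.mem_Icc] at ht
  obtain ⟨k, rfl⟩ : ∃ k, t = k + 1 := ⟨t - 1, by omega⟩
  rcases Nat.eq_zero_or_pos k with rfl | hk
  · rw [zero_add, h.init_x, h.init_lam]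
    exact ⟨hx₁, fun i => le_rfl⟩
  · have hk' : k ∈ Finset.Icc 1 T := Finset.mem_Icc.2 ⟨hk, by omega⟩
    refine ⟨h.mem k hk', fun i => ?_⟩
    rw [h.step_lam k hk' i]
    exact le_max_right _ _

theorem Problem.IsPath.isStep (h : Q.IsPath σ α τ T x₁ z S x lam) (hx₁ : x₁ ∈ Q.X₀)
    (hS : c.Admissible T S) (hz : ∀ t ∈ Finset.Icc 1 T, z t ∈ Q.Xi) {t : ℕ}
    (ht : t ∈ Finset.Icc 1 T) :
    Q.IsStep c σ α τ (x t) (lam t) (z t) (S t) (x (t + 1)) (lam (t + 1)) := by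
  have hst := h.state_mem hx₁ (t := t) (by rw [Finset.mem_Icc] at ht ⊢; omega)
  exact ⟨hst.1, hst.2, hz t ht, h.symm t ht, hS t ht, h.mem t ht, h.argmin t ht, h.step_lam t ht⟩

theorem sum_G_le (hQ : Q.Standing) (hc : c.Pos) (hA : Q.Assumptions c) (hσ : 0 < σ)
    {M : ℝ} (h0 : lam 1 = 0)
    (hstep : ∀ t ∈ Finset.Icc 1 T,
      Q.IsStep c σ α τ (x t) (lam t) (z t) (S t) (x (t + 1)) (lam (t + 1)))
    (hM : ∀ t ∈ Finset.Icc 1 T, ‖x (t + 1) - x t‖ ≤ M) (i : Fin p) :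
    ∑ t ∈ Finset.Icc 1 T, Q.G i (x t) (z t)
      ≤ lam (T + 1) i / σ + T * ((c.κg + c.κS * c.D₀ / 2) * M) := by
  have key : ∀ k ≤ T, ∑ t ∈ Finset.Icc 1 k, Q.G i (x t) (z t)
      ≤ lam (k + 1) i / σ + k * ((c.κg + c.κS * c.D₀ / 2) * M) := by
    intro k
    induction k with
    | zero => intro _; simp [h0]
    | succ k ih =>
      intro hk
      have hmem : k + 1 ∈ Finset.Icc 1 T := Finset.mem_Icc.2 ⟨by omega, hk⟩
      have h1 := (hstep (k + 1) hmem).G_le hQ hc hA hσ i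
      have h2 := ih (by omega)
      have h3 := mul_le_mul_of_nonneg_left (hM (k + 1) hmem)
        (show 0 ≤ c.κg + c.κS * c.D₀ / 2 by
          have := hc.κg; have := hc.κS; have := hc.D₀; positivity)
      rw [Finset.sum_Icc_succ_top (by omega)]
      rw [sub_div] at h1
      push_cast
      linarith
  exact key T le_rfl

end Pathwise

/-! ### The derived constants and the order of the bound. -/

section Constants

variable {p : ℕ} {c : Constants p}

theorem Constants.Pos.ν_le_γ₁ (hc : c.Pos) : c.ν ≤ c.γ₁ := by
  have := hc.κg; have := hc.κS; have := hc.D₀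
  have h : 0 ≤ Real.sqrt p * (c.κg * c.D₀ + 1 / 2 * c.κS * c.D₀ ^ 2) := by positivity
  unfold Constants.γ₁
  linarith

theorem Constants.Pos.one_le_β (hc : c.Pos) : 1 ≤ c.β := by
  have := hc.κg; have := hc.κS; have := hc.D₀; have := hc.ν; have := hc.L₀
  have h : 0 ≤ ∑ j, c.γ₂ * c.L j := Finset.sum_nonneg fun j _ => by
    have := hc.L j
    unfold Constants.γ₂
    positivity
  unfold Constants.β
  linarith

/-- The threshold beyond which the Lyapunov function drifts downwards. -/
noncomputable def Constants.threshold (c : Constants p) (u : ℝ) : ℝ :=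
  c.κ₀ + 2 * (u ^ 3)⁻¹ * c.ν ^ 2 / c.ε₀ + 2 * (u ^ 3)⁻¹ * c.ν + c.κ₁ * (1 + c.β * u⁻¹)
    + c.ε₀ * u⁻¹ / 2

/-- Here u stands for T^{1/4}. The left side is the level needed in Chernoff's bound: the drift
threshold, the overshoot of one step, and (η + 2 log(T+1))/r. -/
theorem threshold_le_phiHat (hc : c.Pos) (hεν : c.ε₀ ≤ c.ν) {T : ℕ} {u η : ℝ} (hu : 1 ≤ u)
    (h1 : (T : ℝ) ^ (-(1 / 4) : ℝ) = u⁻¹) (h3 : (T : ℝ) ^ (-(3 / 4) : ℝ) = (u ^ 3)⁻¹)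
    (hη : 0 ≤ η) :
    c.threshold u + 5 / 2 * (u ^ 3)⁻¹ * c.ν
      + (η + 2 * Real.log ((T : ℝ) + 1)) * (4 * (u ^ 3)⁻¹ * c.ν ^ 2 / c.ε₀) ≤ c.phiHat T η := by
  have hε := hc.ε₀
  have hν := hc.ν
  have hγ := hc.ν_le_γ₁
  have hβ := hc.one_le_β
  have hlog : 0 ≤ Real.log ((T : ℝ) + 1) := Real.log_nonneg (by simp)
  have hu0 : 0 < u := by linarith
  have hv : (u ^ 3)⁻¹ ≤ u⁻¹ := by
    apply inv_anti₀ hu0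
    exact le_self_pow₀ hu (by norm_num)
  have hw0 : 0 < (u ^ 3)⁻¹ := by positivity
  -- As γ₁ ≥ ε₀, the logarithm in κ₄ is at least 1. The surplus 18γ₁ absorbs the negative part of κ₃
  -- and the lower-order terms of the threshold.
  have hκ4 : 18 * c.γ₁ + c.ε₀ / 4 ≤ c.κ₄ := by
    have hγε : 1 ≤ c.γ₁ / c.ε₀ := by rw [one_le_div hε]; linarith
    have hl : 1 ≤ Real.log (128 * c.γ₁ ^ 2 / c.ε₀ ^ 2) := by
      rw [Real.le_log_iff_exp_le (by have : 0 < c.γ₁ := by linarith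
                                     positivity)]
      have e : 128 * c.γ₁ ^ 2 / c.ε₀ ^ 2 = 128 * (c.γ₁ / c.ε₀) ^ 2 := by rw [div_pow]; ring
      rw [e]
      have := Real.exp_one_lt_d9
      nlinarith
    have e : 16 * c.γ₁ ^ 2 / c.ε₀ = 16 * c.γ₁ * (c.γ₁ / c.ε₀) := by ring
    have h5 : 16 * c.γ₁ ≤ 16 * c.γ₁ ^ 2 / c.ε₀ := by
      rw [e]; exact le_mul_of_one_le_right (by linarith) hγε
    have h6 : 16 * c.γ₁ ^ 2 / c.ε₀ ≤
        16 * c.γ₁ ^ 2 / c.ε₀ * Real.log (128 * c.γ₁ ^ 2 / c.ε₀ ^ 2) :=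
      le_mul_of_one_le_right (by positivity) hl
    unfold Constants.κ₄
    linarith
  have hlast : (η + 2 * Real.log ((T : ℝ) + 1)) * (4 * (u ^ 3)⁻¹ * c.ν ^ 2 / c.ε₀) ≤
      16 * c.β * (c.γ₁ ^ 2 / c.ε₀) * (η + Real.log ((T : ℝ) + 1)) * u⁻¹ := by
    have a1 : c.ν ^ 2 / c.ε₀ ≤ c.γ₁ ^ 2 / c.ε₀ := by gcongr
    have a0 : 0 ≤ c.ν ^ 2 / c.ε₀ := by positivity
    have a2 : (u ^ 3)⁻¹ * (c.ν ^ 2 / c.ε₀) ≤ u⁻¹ * (c.γ₁ ^ 2 / c.ε₀) :=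
      mul_le_mul hv a1 a0 (by positivity)
    calc (η + 2 * Real.log ((T : ℝ) + 1)) * (4 * (u ^ 3)⁻¹ * c.ν ^ 2 / c.ε₀)
        = 4 * (η + 2 * Real.log ((T : ℝ) + 1)) * ((u ^ 3)⁻¹ * (c.ν ^ 2 / c.ε₀)) := by ring
      _ ≤ 16 * (η + Real.log ((T : ℝ) + 1)) * (u⁻¹ * (c.γ₁ ^ 2 / c.ε₀)) :=
          mul_le_mul (by linarith) a2 (by positivity) (by linarith)
      _ ≤ c.β * (16 * (η + Real.log ((T : ℝ) + 1)) * (u⁻¹ * (c.γ₁ ^ 2 / c.ε₀))) :=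
          le_mul_of_one_le_left (by positivity) hβ
      _ = _ := by ring
  have b1 := mul_le_mul_of_nonneg_right hκ4 (inv_pos.2 hu0).le
  have b2 := mul_le_mul_of_nonneg_right hγ hw0.le
  have b3 := mul_le_mul_of_nonneg_left hv (hν.le.trans hγ)
  have b4 := mul_le_mul_of_nonneg_right (hεν.trans hγ) (inv_pos.2 hu0).le
  have b5 := mul_pos (hν.trans_le hγ) (inv_pos.2 hu0)
  have b6 := mul_pos hε (inv_pos.2 hu0)
  unfold Constants.threshold Constants.phiHat Constants.κ₃
  rw [h1, h3]
  have e : 2 * (u ^ 3)⁻¹ * c.ν ^ 2 / c.ε₀ = 2 * c.ν ^ 2 / c.ε₀ * (u ^ 3)⁻¹ := by ring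
  rw [e]
  linarith

/-- The quotient tends to ρ₁/β + (1 + ρ₂/β)(κ₀ + κ₁) > 0. -/
theorem isTheta_piC (hc : c.Pos) (η : ℝ) :
    Asymptotics.IsTheta Filter.atTop (fun N : ℕ => c.piC N η)
      (fun N : ℕ => (N : ℝ) ^ (3 / 4 : ℝ)) := by
  have hβ := hc.one_le_β
  have := hc.κg; have := hc.κS; have := hc.D₀; have := hc.ν; have := hc.κf; have := hc.ε₀
  have hpow : ∀ a : ℝ, 0 < a → Filter.Tendsto (fun N : ℕ => (N : ℝ) ^ (-a)) Filter.atTop (nhds 0) :=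
    fun a ha => (tendsto_rpow_neg_atTop ha).comp tendsto_natCast_atTop_atTop
  have hlog : Filter.Tendsto (fun N : ℕ => Real.log ((N : ℝ) + 1) * (N : ℝ) ^ (-(1 / 4) : ℝ))
      Filter.atTop (nhds 0) := by
    -- Any exponent below 1/4 would do to dominate the logarithm; 1/8 leaves the decay N^{-1/8}.
    have hb := (hpow (1 / 8) (by norm_num)).const_mul (2 ^ (1 / 8 : ℝ) / (1 / 8))
    rw [mul_zero] at hb
    refine squeeze_zero' ?_ ?_ hb
    · filter_upwards with N
      exact mul_nonneg (Real.log_nonneg (by simp)) (by positivity)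
    · filter_upwards [Filter.eventually_ge_atTop 1] with N hN
      have hN' : (1 : ℝ) ≤ N := by exact_mod_cast hN
      have h1 := Real.log_le_rpow_div (x := (N : ℝ) + 1) (by positivity)
        (show (0 : ℝ) < 1 / 8 by norm_num)
      have h2 : ((N : ℝ) + 1) ^ (1 / 8 : ℝ) ≤ 2 ^ (1 / 8 : ℝ) * (N : ℝ) ^ (1 / 8 : ℝ) := by
        rw [← Real.mul_rpow (by norm_num) (by positivity)]
        exact Real.rpow_le_rpow (by positivity) (by linarith) (by norm_num)
      calc Real.log ((N : ℝ) + 1) * (N : ℝ) ^ (-(1 / 4) : ℝ)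
          ≤ (2 ^ (1 / 8 : ℝ) * (N : ℝ) ^ (1 / 8 : ℝ)) / (1 / 8) * (N : ℝ) ^ (-(1 / 4) : ℝ) := by
            gcongr
            exact h1.trans (by gcongr)
        _ = 2 ^ (1 / 8 : ℝ) / (1 / 8) * ((N : ℝ) ^ (1 / 8 : ℝ) * (N : ℝ) ^ (-(1 / 4) : ℝ)) := by
            ring
        _ = 2 ^ (1 / 8 : ℝ) / (1 / 8) * (N : ℝ) ^ (-(1 / 8) : ℝ) := by
            rw [← Real.rpow_add (by linarith)]; norm_num
  have hphi : Filter.Tendsto (fun N : ℕ => c.phiHat N η) Filter.atTop (nhds (c.κ₀ + c.κ₁)) := by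
    have h1 := (hpow (1 / 4) (by norm_num)).const_mul (c.κ₁ * c.β + c.κ₄)
    have h2 := (hpow (3 / 4) (by norm_num)).const_mul c.κ₃
    have h3 := (((hpow (1 / 4) (by norm_num)).const_mul η).add hlog).const_mul
      (16 * c.β * (c.γ₁ ^ 2 / c.ε₀))
    have h4 := (((tendsto_const_nhds (x := c.κ₀ + c.κ₁)).add h1).add h2).add h3
    simp only [mul_zero, add_zero] at h4
    refine h4.congr fun N => ?_
    unfold Constants.phiHat
    ring
  have hlim : Filter.Tendsto (fun N : ℕ => c.piC N η / (N : ℝ) ^ (3 / 4 : ℝ)) Filter.atTop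
      (nhds (c.ρ₁ * c.β⁻¹ + (1 + c.β⁻¹ * c.ρ₂) * (c.κ₀ + c.κ₁))) := by
    have h1 := (hpow (3 / 4) (by norm_num)).const_mul (c.ρ₂ * c.β⁻¹ * c.ν)
    have h2 := (hpow (1 / 4) (by norm_num)).const_mul (η * c.ρc)
    have h4 := (((tendsto_const_nhds (x := c.ρ₁ * c.β⁻¹)).add h1).add h2).add
      (hphi.const_mul (1 + c.β⁻¹ * c.ρ₂))
    simp only [mul_zero, add_zero] at h4
    refine h4.congr' ?_
    filter_upwards [Filter.eventually_ge_atTop 1] with N hN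
    have hN' : (0 : ℝ) < N := by exact_mod_cast hN
    have hp : (0 : ℝ) < (N : ℝ) ^ (3 / 4 : ℝ) := by positivity
    have e1 : (N : ℝ) ^ (-(3 / 4) : ℝ) = ((N : ℝ) ^ (3 / 4 : ℝ))⁻¹ := Real.rpow_neg hN'.le _
    have e2 : (N : ℝ) ^ (-(1 / 4) : ℝ) = Real.sqrt N / (N : ℝ) ^ (3 / 4 : ℝ) := by
      rw [Real.sqrt_eq_rpow, ← Real.rpow_sub hN']; norm_num
    rw [e1, e2]
    unfold Constants.piC
    field_simp
  have hpos : 0 < c.ρ₁ * c.β⁻¹ + (1 + c.β⁻¹ * c.ρ₂) * (c.κ₀ + c.κ₁) := by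
    have hβ0 : 0 < c.β := by linarith
    unfold Constants.ρ₁ Constants.ρ₂ Constants.κ₀ Constants.κ₁
    positivity
  exact (Asymptotics.isTheta_of_div_tendsto_nhds_ne_zero hlim hpos.ne').symm

end Constants

/-! ### Chernoff's bound and the two exceptional events. -/

theorem measurable_sqrt_norm_sq_add {n p : ℕ} {Ω : Type*} {m : MeasurableSpace Ω} {l : Ω → Vec p}
    {x : Ω → Vec n} (hl : Measurable l) (hx : Measurable x) (a : ℝ) (z : Vec n) :
    Measurable fun ω => Real.sqrt (‖l ω‖ ^ 2 + a * ‖z - x ω‖ ^ 2) := by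
  fun_prop

/-- Chernoff bound. -/
theorem measure_gt_le_of_lintegral_exp_le {Ω : Type*} [MeasurableSpace Ω] {Pr : Measure Ω}
    {X : Ω → ℝ} (hX : Measurable X) {γ B R : ℝ} (hγ : 0 ≤ γ)
    (h : ∫⁻ ω, ENNReal.ofReal (Real.exp (γ * X ω)) ∂Pr ≤ ENNReal.ofReal B) :
    Pr {ω | R < X ω} ≤ ENNReal.ofReal (B * Real.exp (-(γ * R))) := by
  have h1 := mul_meas_ge_le_lintegral (μ := Pr)
    (f := fun ω => ENNReal.ofReal (Real.exp (γ * X ω))) (by fun_prop)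
    (ENNReal.ofReal (Real.exp (γ * R)))
  have h2 : {ω | R < X ω} ⊆
      {ω | ENNReal.ofReal (Real.exp (γ * R)) ≤ ENNReal.ofReal (Real.exp (γ * X ω))} := by
    intro ω hω
    have hω : R < X ω := hω
    exact ENNReal.ofReal_le_ofReal (Real.exp_le_exp.2 (mul_le_mul_of_nonneg_left hω.le hγ))
  have e : ENNReal.ofReal (Real.exp (-(γ * R))) * ENNReal.ofReal (Real.exp (γ * R)) = 1 := by
    rw [← ENNReal.ofReal_mul (Real.exp_pos _).le, ← Real.exp_add]; simp
  calc Pr {ω | R < X ω} ≤ _ := measure_mono h2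
    _ = ENNReal.ofReal (Real.exp (-(γ * R))) * (ENNReal.ofReal (Real.exp (γ * R)) *
          Pr {ω | ENNReal.ofReal (Real.exp (γ * R)) ≤ ENNReal.ofReal (Real.exp (γ * X ω))}) := by
        rw [← mul_assoc, e, one_mul]
    _ ≤ ENNReal.ofReal (Real.exp (-(γ * R))) * ENNReal.ofReal B := by
        gcongr
        exact h1.trans h
    _ = ENNReal.ofReal (B * Real.exp (-(γ * R))) := by
        rw [← ENNReal.ofReal_mul (Real.exp_pos _).le, mul_comm]

section Events

variable {n p q : ℕ} {Ω : Type*} [MeasurableSpace Ω] {Pr : Measure Ω} [IsProbabilityMeasure Pr]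
  {Q : Problem n p q} {c : Constants p} {ξ : ℕ → Ω → Vec q}

/-- Concentration of the constraint sampling errors along the iterates. -/
theorem measure_samplingError_le (hQ : Q.Standing) (hc : c.Pos) (hC : Q.LightTail c)
    (hξ : Q.IsIIDSample Pr ξ) {T : ℕ} (hT : 1 ≤ T) {x : ℕ → Ω → Vec n}
    (hx : ∀ t ∈ Finset.Icc 1 T, Measurable[history ξ t] (x t))
    (hxm : ∀ᵐ ω ∂Pr, ∀ t ∈ Finset.Icc 1 T, x t ω ∈ Q.X₀) (i : Fin p) {η : ℝ} (hη : 0 ≤ η) :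
    Pr {ω | η * c.ρc * Real.sqrt T
        < ∑ t ∈ Finset.Icc 1 T, (Q.g i (x t ω) - Q.G i (x t ω) (ξ t ω))}
      ≤ ENNReal.ofReal (Real.exp (-η ^ 2 / 3)) := by
  have := hQ.prob
  have hρ := hc.ρc
  obtain ⟨f, hf, hfeq, hf0⟩ := exists_measurable_eq_of_continuousOn (μ := Q.law)
    hQ.closed_X₀.measurableSet (u := fun x s => Q.g i x - Q.G i x s)
    (fun x hx => aestronglyMeasurable_const.sub
      (hQ.integrable_G i x (hQ.subset hx)).aestronglyMeasurable)
    (by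
      filter_upwards [hQ.support] with s hs
      refine ((hQ.continuous_g i).mono hQ.subset).sub fun y hy => ?_
      exact (hQ.diff_G i s hs y (hQ.subset hy)).continuousAt.continuousWithinAt)
  have hsT : 0 < Real.sqrt T := Real.sqrt_pos.2 (by exact_mod_cast hT)
  have hsq : Real.sqrt T ^ 2 = T := Real.sq_sqrt (Nat.cast_nonneg T)
  -- Minimizer of (3/4)γ²ρ_c²T - γηρ_c√T, whose minimum is -η²/3.
  set γ : ℝ := 2 * η / (3 * c.ρc * Real.sqrt T) with hγ
  have hγ0 : 0 ≤ γ := by positivity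
  have hfK : ∀ a, ∫⁻ s, ENNReal.ofReal (Real.exp (γ * f (a, s))) ∂Q.law
      ≤ ENNReal.ofReal (Real.exp (3 / 4 * (γ * c.ρc) ^ 2)) := by
    intro a
    by_cases ha : a ∈ Q.X₀
    · have hGi := hQ.integrable_G i a (hQ.subset ha)
      have hlt := hC a ha i
      have e : ∀ s, (Q.g i a - Q.G i a s) ^ 2 = (Q.G i a s - Q.g i a) ^ 2 := fun s => by ring
      have h1 := lintegral_exp_le_of_lightTail (μ := Q.law) (X := fun s => Q.g i a - Q.G i a s)
        (γ := γ) ((integrable_const _).sub hGi) (by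
          rw [integral_sub (integrable_const _) hGi]
          simp [Problem.g]) hρ (by simpa only [e] using hlt.1) (by simpa only [e] using hlt.2)
      refine le_trans (le_of_eq (lintegral_congr_ae ?_)) h1
      filter_upwards [hfeq] with s hs
      rw [hs a ha]
    · simp only [hf0 a ha, mul_zero, Real.exp_zero, lintegral_const, measure_univ, mul_one]
      exact ENNReal.ofReal_le_ofReal (Real.one_le_exp (by positivity))
  have hsum := hξ.lintegral_exp_sum_le hx hf (Real.exp_pos _).le hfK T le_rfl
  have hmeas : Measurable fun ω => ∑ t ∈ Finset.Icc 1 T, f (x t ω, ξ t ω) := by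
    refine Finset.measurable_fun_sum _ fun t ht => hf.comp (Measurable.prodMk ?_ ?_)
    · exact (hx t ht).mono (hξ.history_le t) le_rfl
    · exact hξ.meas t (Finset.mem_Icc.1 ht).1
  have hch := measure_gt_le_of_lintegral_exp_le (R := η * c.ρc * Real.sqrt T) hmeas hγ0 hsum
  have hval : Real.exp (3 / 4 * (γ * c.ρc) ^ 2) ^ T * Real.exp (-(γ * (η * c.ρc * Real.sqrt T)))
      = Real.exp (-η ^ 2 / 3) := by
    rw [← Real.exp_nat_mul, ← Real.exp_add]
    congr 1
    rw [hγ]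
    generalize Real.sqrt (T : ℝ) = w at hsT hsq ⊢
    rw [← hsq]
    field_simp
    ring
  rw [hval] at hch
  refine le_trans (le_of_eq (measure_congr ?_)) hch
  have hall : ∀ᵐ ω ∂Pr, ∀ t ∈ Finset.Icc 1 T, ∀ y ∈ Q.X₀,
      f (y, ξ t ω) = Q.g i y - Q.G i y (ξ t ω) := by
    rw [Filter.eventually_all_finset]
    intro t ht
    exact hξ.ae_comp (Finset.mem_Icc.1 ht).1 hfeq
  filter_upwards [hall, hxm] with ω h1 h2
  have : ∑ t ∈ Finset.Icc 1 T, f (x t ω, ξ t ω)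
      = ∑ t ∈ Finset.Icc 1 T, (Q.g i (x t ω) - Q.G i (x t ω) (ξ t ω)) :=
    Finset.sum_congr rfl fun t ht => h1 t ht _ (h2 t ht)
  show (_ < _) = (_ < _)
  rw [this]

/-- High-probability bound for the multipliers. -/
theorem measure_norm_lam_gt_le (hQ : Q.Standing) (hc : c.Pos) (hA : Q.Assumptions c)
    (hε : Real.sqrt p * c.κS * c.D₀ ^ 2 ≤ c.ε₀) (hεν : c.ε₀ ≤ c.ν)
    (hξ : Q.IsIIDSample Pr ξ) {T : ℕ} {u : ℝ} (hu : 1 ≤ u)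
    (h1 : (T : ℝ) ^ (-(1 / 4) : ℝ) = u⁻¹) (h3 : (T : ℝ) ^ (-(3 / 4) : ℝ) = (u ^ 3)⁻¹)
    {x : ℕ → Ω → Vec n} {lam : ℕ → Ω → Vec p} {S : ℕ → Fin p → Ω → Op n}
    (hx : ∀ t ∈ Finset.Icc 1 (T + 1), Measurable[history ξ t] (x t))
    (hlam : ∀ t ∈ Finset.Icc 1 (T + 1), Measurable[history ξ t] (lam t))
    (hlam1 : ∀ᵐ ω ∂Pr, lam 1 ω = 0)
    (hmem : ∀ᵐ ω ∂Pr, ∀ t ∈ Finset.Icc 1 (T + 1), x t ω ∈ Q.X₀ ∧ ∀ i, 0 ≤ lam t ω i)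
    (hstep : ∀ᵐ ω ∂Pr, ∀ t ∈ Finset.Icc 1 T, Q.IsStep c ((u ^ 3)⁻¹) (c.β * u) (u ^ 2)
      (x t ω) (lam t ω) (ξ t ω) (fun i => S t i ω) (x (t + 1) ω) (lam (t + 1) ω))
    {η : ℝ} (hη : 0 ≤ η) :
    Pr {ω | ∃ t ∈ Finset.Icc 1 (T + 1), c.phiHat T η < ‖lam t ω‖}
      ≤ ENNReal.ofReal (Real.exp (-η)) := by
  have := hQ.prob
  obtain ⟨z, hz, hzε⟩ := hA.slater
  have hβ := hc.one_le_β
  have hu0 : 0 < u := by linarith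
  have hν := hc.ν
  have hε0 := hc.ε₀
  have hD := hc.D₀
  have hκf := hc.κf
  set σ : ℝ := (u ^ 3)⁻¹ with hσ
  have hσ0 : 0 < σ := by positivity
  set a : ℝ := σ * (u ^ 2 + c.β * u) with ha
  have ha0 : 0 ≤ a := by positivity
  set V : ℕ → Ω → ℝ := fun t ω => Real.sqrt (‖lam t ω‖ ^ 2 + a * ‖z - x t ω‖ ^ 2) with hV
  have hVsq : ∀ t ω, V t ω ^ 2 = ‖lam t ω‖ ^ 2 + a * ‖z - x t ω‖ ^ 2 :=
    fun t ω => Real.sq_sqrt (by positivity)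
  have hlV : ∀ t ω, ‖lam t ω‖ ≤ V t ω := fun t ω =>
    Real.le_sqrt_of_sq_le (by have : 0 ≤ a * ‖z - x t ω‖ ^ 2 := by positivity
                              linarith)
  set θ : ℝ := c.threshold u with hθ
  have hκ0 : 0 < c.κ₀ := by unfold Constants.κ₀; positivity
  have hκ1 : 0 < c.κ₁ := by unfold Constants.κ₁; positivity
  have hβ0 : 0 < c.β := by linarith
  -- The last two terms of the threshold are chosen for this: a D₀² is exactly their product, so
  -- AM-GM applies. Above θ the multipliers thus carry most of V.
  have hθA : 4 * (a * c.D₀ ^ 2) ≤ θ ^ 2 := by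
    have e1 : c.κ₁ * (1 + c.β * u⁻¹) + c.ε₀ * u⁻¹ / 2 ≤ θ := by
      have : 0 ≤ 2 * (u ^ 3)⁻¹ * c.ν ^ 2 / c.ε₀ + 2 * (u ^ 3)⁻¹ * c.ν := by positivity
      rw [hθ]
      unfold Constants.threshold
      linarith
    have e2 : 4 * (a * c.D₀ ^ 2) = 4 * (c.κ₁ * (1 + c.β * u⁻¹)) * (c.ε₀ * u⁻¹ / 2) := by
      rw [ha, hσ]
      unfold Constants.κ₁
      field_simp
    have e3 : 0 ≤ c.κ₁ * (1 + c.β * u⁻¹) + c.ε₀ * u⁻¹ / 2 := by positivity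
    calc 4 * (a * c.D₀ ^ 2) ≤ (c.κ₁ * (1 + c.β * u⁻¹) + c.ε₀ * u⁻¹ / 2) ^ 2 := by
          rw [e2]; linarith [sq_nonneg (c.κ₁ * (1 + c.β * u⁻¹) - c.ε₀ * u⁻¹ / 2)]
      _ ≤ θ ^ 2 := pow_le_pow_left₀ e3 e1 2
  have hθ0 : 0 < θ := by rw [hθ]; unfold Constants.threshold; positivity
  set C : ℝ := c.κf * c.D₀ + σ * c.ν ^ 2 / 2 + c.ε₀ * σ * c.ν / 2 with hCdef
  have hC0 : 0 ≤ C := by positivity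
  -- The first three terms of the threshold, times ε₀, equal 4C.
  have hCθ : 4 * C ≤ c.ε₀ * θ := by
    have e : c.ε₀ * (c.κ₀ + 2 * σ * c.ν ^ 2 / c.ε₀ + 2 * σ * c.ν) = 4 * C := by
      rw [hCdef]; unfold Constants.κ₀; field_simp; ring
    rw [← e]
    apply mul_le_mul_of_nonneg_left _ hε0.le
    have : 0 ≤ c.κ₁ * (1 + c.β * u⁻¹) + c.ε₀ * u⁻¹ / 2 := by positivity
    rw [hθ]
    unfold Constants.threshold
    linarith
  set r : ℝ := c.ε₀ / (4 * σ * c.ν ^ 2) with hr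
  have hr0 : 0 < r := by positivity
  have hGz : ∀ i, AEMeasurable (Q.G i z) Q.law := fun i =>
    (hQ.integrable_G i z (hQ.subset hz)).aestronglyMeasurable.aemeasurable
  set Y : Vec q → Vec p := fun s => WithLp.toLp 2 fun i => (hGz i).mk _ s with hY
  have hYm : Measurable Y := by
    have : Measurable fun s => fun i => (hGz i).mk _ s :=
      measurable_pi_iff.2 fun i => (hGz i).measurable_mk
    exact (WithLp.measurable_toLp 2 _).comp this
  have hYG : ∀ᵐ s ∂Q.law, ∀ i, Y s i = Q.G i z s := by
    rw [ae_all_iff]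
    intro i
    filter_upwards [(hGz i).ae_eq_mk] with s hs
    exact hs.symm
  have hYν : ∀ᵐ s ∂Q.law, ‖Y s‖ ≤ c.ν := by
    filter_upwards [hYG, hQ.support] with s hs hsX
    have e : Y s = WithLp.toLp 2 (fun i => Q.G i z s) := by ext i; exact hs i
    rw [e]
    exact hA.bound_G z (hQ.subset hz) s hsX
  have hYε : ∀ i, ∫ s, Y s i ∂Q.law ≤ -c.ε₀ := by
    intro i
    refine le_trans (le_of_eq (integral_congr_ae ?_)) (hzε i)
    filter_upwards [hYG] with s hs using hs i
  have hVm : ∀ t ∈ Finset.Icc 1 (T + 1), Measurable[history ξ t] (V t) := by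
    intro t ht
    exact measurable_sqrt_norm_sq_add (hlam t ht) (hx t ht) a z
  have hdiam : ∀ᵐ ω ∂Pr, ∀ t ∈ Finset.Icc 1 (T + 1), a * ‖z - x t ω‖ ^ 2 ≤ a * c.D₀ ^ 2 := by
    filter_upwards [hmem] with ω h t ht
    exact mul_le_mul_of_nonneg_left (Problem.IsStep.norm_sub_sq_le hA hz (h t ht).1) ha0
  -- The drift estimate adds one constant per step, so the moment grows linearly in k.
  have hind : ∀ k ≤ T, ∫⁻ ω, ENNReal.ofReal (Real.exp (r * V (k + 1) ω)) ∂Pr ≤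
      ENNReal.ofReal (((k : ℝ) + 1) * Real.exp (r * (θ + 5 / 2 * σ * c.ν))) := by
    intro k
    induction k with
    | zero =>
      intro _
      have hb : ∀ᵐ ω ∂Pr, ENNReal.ofReal (Real.exp (r * V 1 ω)) ≤
          ENNReal.ofReal (Real.exp (r * (θ + 5 / 2 * σ * c.ν))) := by
        filter_upwards [hlam1, hdiam] with ω h0 hd
        apply ENNReal.ofReal_le_ofReal
        apply Real.exp_le_exp.2
        apply mul_le_mul_of_nonneg_left _ hr0.le
        have hd1 := hd 1 (by simp)
        have e1 : V 1 ω ^ 2 ≤ θ ^ 2 := by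
          rw [hVsq, h0, norm_zero]
          nlinarith [mul_nonneg ha0 (sq_nonneg c.D₀)]
        have e2 := abs_le_of_sq_le_sq e1 hθ0.le
        have e3 : 0 ≤ 5 / 2 * σ * c.ν := by positivity
        linarith [le_abs_self (V 1 ω)]
      refine (lintegral_mono_ae hb).trans ?_
      simp
    | succ k ih =>
      intro hk
      have ht : k + 1 ∈ Finset.Icc 1 T := Finset.mem_Icc.2 ⟨by omega, hk⟩
      have ht' : k + 1 ∈ Finset.Icc 1 (T + 1) := Finset.mem_Icc.2 ⟨by omega, by omega⟩
      have hdr := hξ.lintegral_exp_drift (t := k + 1) (by omega) (V' := V (k + 1 + 1))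
        (hlam _ ht') (hVm _ ht') hYm hε0 hεν hσ0 hθ0 hCθ hC0 hYν hYε
        (by
          filter_upwards [hmem, hdiam] with ω h1 h2
          refine ⟨(h1 _ ht').2, hlV _ _, fun hθV => ?_⟩
          have e1 : θ ^ 2 ≤ V (k + 1) ω ^ 2 := pow_le_pow_left₀ hθ0.le hθV 2
          have e2 := h2 _ ht'
          have e3 := hVsq (k + 1) ω
          apply le_of_sq_le_sq _ (norm_nonneg _)
          nlinarith [sq_nonneg (V (k + 1) ω)])
        (by
          filter_upwards [hstep, hξ.ae_comp (t := k + 1) (by omega) hYG] with ω h1 h2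
          have := (h1 _ ht).lyapunov hQ hc hA hσ0 (by positivity) hε hz
          rw [hVsq, hVsq]
          rw [← ha, ← hCdef] at this
          simp only [h2]
          exact this)
      refine hdr.trans ((add_le_add (ih (by omega)) le_rfl).trans ?_)
      rw [← ENNReal.ofReal_add (by positivity) (Real.exp_pos _).le]
      apply ENNReal.ofReal_le_ofReal
      push_cast
      linarith
  set E : ℝ := Real.exp (r * (θ + 5 / 2 * σ * c.ν)) * Real.exp (-(r * c.phiHat T η)) with hE
  have hone : ∀ t ∈ Finset.Icc 1 (T + 1),
      Pr {ω | c.phiHat T η < V t ω} ≤ ENNReal.ofReal (((T : ℝ) + 1) * E) := by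
    intro t ht
    rw [Finset.mem_Icc] at ht
    obtain ⟨k, rfl⟩ : ∃ k, t = k + 1 := ⟨t - 1, by omega⟩
    have hm : Measurable (V (k + 1)) :=
      (hVm _ (Finset.mem_Icc.2 ht)).mono (hξ.history_le _) le_rfl
    refine (measure_gt_le_of_lintegral_exp_le hm hr0.le (hind k (by omega))).trans ?_
    apply ENNReal.ofReal_le_ofReal
    rw [mul_assoc]
    have : (k : ℝ) ≤ T := by exact_mod_cast (by omega : k ≤ T)
    gcongr
  -- One factor T + 1 comes from the moment bound, the other from the union bound; together they
  -- account for 2 log(T+1).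
  have hfin : ((T : ℝ) + 1) * (((T : ℝ) + 1) * E) ≤ Real.exp (-η) := by
    have hT1 : (0 : ℝ) < (T : ℝ) + 1 := by positivity
    have hphi := threshold_le_phiHat hc hεν hu h1 h3 hη
    rw [← hσ, ← hθ] at hphi
    have e1 : (η + 2 * Real.log ((T : ℝ) + 1)) * (4 * σ * c.ν ^ 2 / c.ε₀)
        = (η + 2 * Real.log ((T : ℝ) + 1)) / r := by
      rw [hr]; field_simp
    rw [e1] at hphi
    have e2 := mul_le_mul_of_nonneg_left hphi hr0.le
    have e3 : r * (θ + 5 / 2 * σ * c.ν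
        + (η + 2 * Real.log ((T : ℝ) + 1)) / r) = r * (θ + 5 / 2 * σ * c.ν)
        + (η + 2 * Real.log ((T : ℝ) + 1)) := by
      field_simp
    rw [e3] at e2
    have e4 : ((T : ℝ) + 1) * (((T : ℝ) + 1) * E) = Real.exp (2 * Real.log ((T : ℝ) + 1)
        + (r * (θ + 5 / 2 * σ * c.ν) + -(r * c.phiHat T η))) := by
      rw [two_mul, Real.exp_add, Real.exp_add, Real.exp_log hT1, Real.exp_add]
      ring
    rw [e4]
    apply Real.exp_le_exp.2
    linarith
  have hsub : {ω | ∃ t ∈ Finset.Icc 1 (T + 1), c.phiHat T η < ‖lam t ω‖} ⊆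
      ⋃ t ∈ Finset.Icc 1 (T + 1), {ω | c.phiHat T η < V t ω} := by
    rintro ω ⟨t, ht, hlt⟩
    exact Set.mem_iUnion₂.2 ⟨t, ht, hlt.trans_le (hlV t ω)⟩
  calc Pr {ω | ∃ t ∈ Finset.Icc 1 (T + 1), c.phiHat T η < ‖lam t ω‖}
      ≤ ∑ t ∈ Finset.Icc 1 (T + 1), Pr {ω | c.phiHat T η < V t ω} :=
        (measure_mono hsub).trans (measure_biUnion_finset_le _ _)
    _ ≤ ∑ _t ∈ Finset.Icc 1 (T + 1), ENNReal.ofReal (((T : ℝ) + 1) * E) :=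
        Finset.sum_le_sum hone
    _ = ENNReal.ofReal (((T : ℝ) + 1) * (((T : ℝ) + 1) * E)) := by
        rw [Finset.sum_const, Nat.card_Icc, nsmul_eq_mul, Nat.add_sub_cancel,
          ← ENNReal.ofReal_natCast, ← ENNReal.ofReal_mul (Nat.cast_nonneg _)]
        push_cast
        rfl
    _ ≤ ENNReal.ofReal (Real.exp (-η)) := ENNReal.ofReal_le_ofReal hfin

end Events

/-- At the Slater point, -ν ≤ g_i ≤ -ε₀. The index `i` guarantees that there is a constraint. -/
theorem Problem.Assumptions.ε₀_le_ν {n p q : ℕ} {Q : Problem n p q} {c : Constants p}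
    (hQ : Q.Standing) (hA : Q.Assumptions c) (i : Fin p) : c.ε₀ ≤ c.ν := by
  have := hQ.prob
  obtain ⟨z, hz, hzε⟩ := hA.slater
  have h1 : -c.ν ≤ Q.g i z := by
    have h2 : ∫ _s, (-c.ν) ∂Q.law ≤ ∫ s, Q.G i z s ∂Q.law := by
      refine integral_mono_ae (integrable_const _) (hQ.integrable_G i z (hQ.subset hz)) ?_
      filter_upwards [hQ.support] with s hs
      have e1 := PiLp.norm_apply_le (WithLp.toLp 2 (fun i => Q.G i z s) : Vec p) i
      exact neg_le_of_abs_le (e1.trans (hA.bound_G z (hQ.subset hz) s hs))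
    simpa [Problem.g] using h2
  linarith [hzε i]

end PMQS

/-! ### Assembly of the deterministic and probabilistic bounds. -/

theorem mainTheorem7 {n p q : ℕ} (Q : PMQS.Problem n p q) (c : PMQS.Constants p)
    (hQ : Q.Standing) (hc : c.Pos) (hA : Q.Assumptions c) (hC : Q.LightTail c)
    {Ω : Type*} [MeasurableSpace Ω] (Pr : MeasureTheory.Measure Ω)
    [MeasureTheory.IsProbabilityMeasure Pr]
    (ξ : ℕ → Ω → PMQS.Vec q) (hξ : Q.IsIIDSample Pr ξ)
    (T : ℕ)
    (hT : (T : ℝ) > max (c.β ^ 2)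
      (max (c.β⁻¹ * p * (c.κg + c.κS * c.D₀ / 2) ^ 2) ((c.κS * c.γ₂) ^ 4)))
    (hε : Real.sqrt p * c.κS * c.D₀ ^ 2 ≤ c.ε₀)
    (x₁ : PMQS.Vec n) (hx₁ : x₁ ∈ Q.X₀)
    (S : ℕ → Fin p → Ω → PMQS.Op n) (x : ℕ → Ω → PMQS.Vec n) (lam : ℕ → Ω → PMQS.Vec p)
    (hS : ∀ᵐ ω ∂Pr, c.Admissible T (fun t i => S t i ω))
    (hpath : ∀ᵐ ω ∂Pr,
      Q.IsPath ((T : ℝ) ^ (-(3 / 4) : ℝ)) (c.β * (T : ℝ) ^ (1 / 4 : ℝ)) ((T : ℝ) ^ (1 / 2 : ℝ))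
        T x₁ (fun t => ξ t ω) (fun t i => S t i ω) (fun t => x t ω) (fun t => lam t ω))
    (hx : ∀ t ∈ Finset.Icc 1 (T + 1), Measurable[PMQS.history ξ t] (x t))
    (hlam : ∀ t ∈ Finset.Icc 1 (T + 1), Measurable[PMQS.history ξ t] (lam t))
    (η : ℝ) (hη : 1 < η) :
    (∀ i : Fin p,
      Pr.real {ω | ∑ t ∈ Finset.Icc 1 T, Q.g i (x t ω) ≤ c.piC T η}
        ≥ 1 - Real.exp (-η) - Real.exp (-η ^ 2 / 3)) ∧
    Asymptotics.IsTheta Filter.atTop (fun N : ℕ => c.piC N η)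
      (fun N : ℕ => (N : ℝ) ^ (3 / 4 : ℝ)) := by
  refine ⟨fun i => ?_, PMQS.isTheta_piC hc η⟩
  have hβ := hc.one_le_β
  have hβ0 : 0 < c.β := by linarith
  have hT1 : (1 : ℝ) ≤ T := by
    have := (le_max_left _ _).trans_lt hT
    nlinarith
  have hTn : 1 ≤ T := by exact_mod_cast hT1
  have hT0 : (0 : ℝ) ≤ T := by linarith
  set u : ℝ := (T : ℝ) ^ (1 / 4 : ℝ) with hu
  have hu1 : 1 ≤ u := Real.one_le_rpow hT1 (by norm_num)
  have hu0 : 0 < u := by linarith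
  have h1 : (T : ℝ) ^ (-(1 / 4) : ℝ) = u⁻¹ := Real.rpow_neg hT0 _
  have hp3 : (T : ℝ) ^ (3 / 4 : ℝ) = u ^ 3 := by
    rw [hu, ← Real.rpow_natCast, ← Real.rpow_mul hT0]; norm_num
  have h3 : (T : ℝ) ^ (-(3 / 4) : ℝ) = (u ^ 3)⁻¹ := by rw [Real.rpow_neg hT0, hp3]
  have hp2 : (T : ℝ) ^ (1 / 2 : ℝ) = u ^ 2 := by
    rw [hu, ← Real.rpow_natCast, ← Real.rpow_mul hT0]; norm_num
  have hp4 : (T : ℝ) = u ^ 4 := by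
    rw [hu, ← Real.rpow_natCast, ← Real.rpow_mul hT0]; norm_num
  rw [h3, hp2] at hpath
  have hz : ∀ᵐ ω ∂Pr, ∀ t ∈ Finset.Icc 1 T, ξ t ω ∈ Q.Xi := by
    rw [Filter.eventually_all_finset]
    exact fun t ht => hξ.ae_comp (Finset.mem_Icc.1 ht).1 hQ.support
  have hmem : ∀ᵐ ω ∂Pr, ∀ t ∈ Finset.Icc 1 (T + 1), x t ω ∈ Q.X₀ ∧ ∀ i, 0 ≤ lam t ω i := by
    filter_upwards [hpath] with ω h t ht using h.state_mem hx₁ ht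
  have hstep : ∀ᵐ ω ∂Pr, ∀ t ∈ Finset.Icc 1 T, Q.IsStep c ((u ^ 3)⁻¹) (c.β * u) (u ^ 2)
      (x t ω) (lam t ω) (ξ t ω) (fun i => S t i ω) (x (t + 1) ω) (lam (t + 1) ω) := by
    filter_upwards [hpath, hS, hz] with ω h hSω hzω t ht using h.isStep hx₁ hSω hzω ht
  have hlam1 : ∀ᵐ ω ∂Pr, lam 1 ω = 0 := by
    filter_upwards [hpath] with ω h using h.init_lam
  have hsubIcc : ∀ t ∈ Finset.Icc 1 T, t ∈ Finset.Icc 1 (T + 1) := by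
    intro t ht; rw [Finset.mem_Icc] at ht ⊢; omega
  have hB₁ := PMQS.measure_norm_lam_gt_le hQ hc hA hε (hA.ε₀_le_ν hQ i) hξ hu1 h1 h3 hx hlam
    hlam1 hmem hstep (η := η) (by linarith)
  have hB₂ := PMQS.measure_samplingError_le hQ hc hC hξ hTn (fun t ht => hx t (hsubIcc t ht))
    (by filter_upwards [hmem] with ω h t ht using (h t (hsubIcc t ht)).1) i (η := η) (by linarith)
  set B₁ := {ω | ∃ t ∈ Finset.Icc 1 (T + 1), c.phiHat T η < ‖lam t ω‖}
  set B₂ := {ω | η * c.ρc * Real.sqrt T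
        < ∑ t ∈ Finset.Icc 1 T, (Q.g i (x t ω) - Q.G i (x t ω) (ξ t ω))}
  set A := {ω | ∑ t ∈ Finset.Icc 1 T, Q.g i (x t ω) ≤ c.piC T η}
  -- Covering the space almost surely gives the lower bound on the probability of `A` without
  -- showing that `A` is measurable.
  have hcov : ∀ᵐ ω ∂Pr, ω ∈ A ∪ (B₁ ∪ B₂) := by
    filter_upwards [hstep, hlam1] with ω hst h0
    by_cases hb1 : ω ∈ B₁
    · exact Or.inr (Or.inl hb1)
    by_cases hb2 : ω ∈ B₂
    · exact Or.inr (Or.inr hb2)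
    left
    have hΦ : ∀ t ∈ Finset.Icc 1 (T + 1), ‖lam t ω‖ ≤ c.phiHat T η := by
      intro t ht
      by_contra! h
      exact hb1 ⟨t, ht, h⟩
    have hR : ∑ t ∈ Finset.Icc 1 T, (Q.g i (x t ω) - Q.G i (x t ω) (ξ t ω))
        ≤ η * c.ρc * Real.sqrt T := not_lt.1 hb2
    rw [Finset.sum_sub_distrib] at hR
    set Φ := c.phiHat T η with hΦdef
    have hκ : 0 ≤ c.κg + c.κS * c.D₀ / 2 := by
      have := hc.κg; have := hc.κS; have := hc.D₀; positivity
    have hd : ∀ t ∈ Finset.Icc 1 T, ‖x (t + 1) ω - x t ω‖ ≤ 2 / (c.β * u) * (c.κf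
        + (c.κg + c.κS * c.D₀ / 2) * (Real.sqrt p * (Φ + (u ^ 3)⁻¹ * c.ν))) := by
      intro t ht
      have e1 := (hst t ht).norm_step_le hQ hc hA (by positivity) (by positivity)
      have e2 := hΦ t (hsubIcc t ht)
      have e3 : c.κf + (c.κg + c.κS * c.D₀ / 2) * (Real.sqrt p * (‖lam t ω‖ + (u ^ 3)⁻¹ * c.ν))
          ≤ c.κf + (c.κg + c.κS * c.D₀ / 2) * (Real.sqrt p * (Φ + (u ^ 3)⁻¹ * c.ν)) := by
        gcongr
      have e4 := mul_le_mul_of_nonneg_left (e1.trans e3)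
        (show 0 ≤ 2 / (c.β * u) by positivity)
      refine le_trans (le_of_eq ?_) e4
      field_simp
    have hG := PMQS.sum_G_le (T := T) hQ hc hA (by positivity) h0 hst hd i
    have hlast : lam (T + 1) ω i / (u ^ 3)⁻¹ ≤ Φ * u ^ 3 := by
      rw [div_inv_eq_mul]
      apply mul_le_mul_of_nonneg_right _ (by positivity)
      exact (le_abs_self _).trans ((PiLp.norm_apply_le (lam (T + 1) ω) i).trans
        (hΦ (T + 1) (Finset.mem_Icc.2 ⟨by omega, le_rfl⟩)))
    -- An identity: the summands are the sampling error, the last multiplier over σ, and T steps of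
    -- maximal length, with T = u⁴, σ = u⁻³ and α = βu.
    have hpi : c.piC T η = η * c.ρc * Real.sqrt T + Φ * u ^ 3 + T * ((c.κg + c.κS * c.D₀ / 2)
        * (2 / (c.β * u) * (c.κf
        + (c.κg + c.κS * c.D₀ / 2) * (Real.sqrt p * (Φ + (u ^ 3)⁻¹ * c.ν))))) := by
      unfold PMQS.Constants.piC PMQS.Constants.ρ₁ PMQS.Constants.ρ₂
      rw [hp3, ← hΦdef]
      generalize Real.sqrt (T : ℝ) = w
      rw [hp4]
      field_simp
      ring
    show _ ≤ c.piC T η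
    rw [hpi]
    linarith
  have hone : (1 : ENNReal) ≤ Pr A + (ENNReal.ofReal (Real.exp (-η))
      + ENNReal.ofReal (Real.exp (-η ^ 2 / 3))) := by
    calc (1 : ENNReal) = Pr (A ∪ (B₁ ∪ B₂)) := by
          rw [← MeasureTheory.measure_univ (μ := Pr)]
          exact (MeasureTheory.measure_congr (MeasureTheory.ae_eq_univ.2 hcov)).symm
      _ ≤ Pr A + (Pr B₁ + Pr B₂) := (MeasureTheory.measure_union_le _ _).trans
          (add_le_add le_rfl (MeasureTheory.measure_union_le _ _))
      _ ≤ _ := add_le_add le_rfl (add_le_add hB₁ hB₂)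
  rw [← ENNReal.ofReal_add (Real.exp_pos _).le (Real.exp_pos _).le,
    ← MeasureTheory.ofReal_measureReal (μ := Pr) (s := A),
    ← ENNReal.ofReal_add MeasureTheory.measureReal_nonneg (by positivity),
    ENNReal.one_le_ofReal] at hone
  linarith
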